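/- **Theorem (Algorithm 1 is a $2.5$-approximation).** Let $G=(V,E)$ be a finite complete graph with edge costs $c:E\to\mathbb R_{\ge 0}$. A triangle is *violating* if at least one of its three triangle inequalities fails. Let $k\ge 1$ be the number of violating triangles; a vertex is *bad* if it lies in a violating triangle and *good* otherwise, and $V^b,V^g$ are the sets of bad and good vertices. A tour is a Hamiltonian cycle of $G$, and $OPT$ denotes a tour of minimum cost. Algorithm 1 enumerates all *branches* $Q=(q_1,\dots,q_t)$, i.e. all permutations of $V^b$ together with all ways to cut the permutation into consecutive nonempty sequences (*bad chains*) $q_1,\dots,q_t$, $1\le t\le |V^b|$. Write $b_s(q),b_e(q)$ for the first and the last vertex of a chain $q$, and read indices of chains cyclically. In each branch it proceeds as follows. 1. Let $C$ be the cycle on $V^b$ formed by the edges of the chains and the edges $b_e(q_i)b_s(q_{i+1})$. If $V^g=\emptyset$, output $C$. 2. Otherwise compute a minimum-cost spanning forest $F$ of $G[V^g\cup R]$ rooted at $R=\{b_e(q_1),\dots,b_e(q_t)\}$ (every tree contains exactly one vertex of $R$); let $G'$ be the graph on $V$ with the edges of $C$ and $F$, let $O$ be the set of its odd-degree vertices,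 compute a minimum-cost perfect matching $M$ of $G[O]$, and let $H=G'+M$ (a multigraph). 3. Apply ShortCut to $H$: (i) while some $a=b_e(q_i)$ and $b=b_e(q_{i+1})$ are joined by a double edge, delete one of the two copies of $ab$ and, if some good $g$ is adjacent to $a$, replace an edge $ag$ by $gb$; if there is no such $g$, take a good $g$ adjacent to $b$ and replace an edge $bg$ by $ga$; (ii) form an Eulerian tour of the multigraph and regard it as a cyclic sequence $s$ of vertices; (iii) until every bad vertex occurs only once in $s$, delete an occurrence of a bad vertex that occurs at least twice, where the deleted occurrence has a good vertex as a cyclic neighbour in $s$; (iv) delete occurrences of good vertices that occur at least twice until every good vertex occurs only once, and output the resulting cyclic sequence. The output of Algorithm 1 is a cheapest one among the outputs of all its branches. Then, for all choices that the algorithm may make (ties, the choices of $F$, $M$, $g$, the Eulerian tour and the deleted occurrences): * In every branch, the computation never gets stuck, it ends after finitely many operations, and its output is a Hamiltonian cycle of $G$. * Suppose $V^g\neq\emptyset$ and let $OPT$ be any minimum-cost tour. There is a branch that matches $OPT$, which means that $OPT$ is, as a cyclic sequence, of the form $q_1p_1q_2p_2\cdots q_tp_t$ with nonempty sequences $p_i$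 of good vertices. In every branch that matches $OPT$ one has $c(C)\le c(OPT)$, $c(F)\le c(OPT)$ and $c(M)\le \tfrac12 c(OPT)$, and the output of the branch costs at most $2.5\cdot c(OPT)$. * Consequently Algorithm 1 always has an output, and this output is a Hamiltonian cycle of $G$ of cost at most $2.5\cdot c(OPT)$. -/

import Mathlib

namespace ParamTSP

variable {V : Type*} [Fintype V] [DecidableEq V]

/-! ### Multigraphs, tours and costs

The ambient graph is the complete graph on `V`; a cost function is a function on `Sym2 V`, of which
only the values on edges (unordered pairs of distinct vertices) are ever relevant.
A multigraph on the vertex set `V` is given by its multiset of edges. -/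

/-- The cyclically consecutive pairs `(x₁, x₂), …, (xₘ, x₁)` of a sequence `x₁, …, xₘ`. -/
def cyclicPairs (s : List V) : List (V × V) :=
  s.zip (s.rotate 1)

/-- The edges `{x₁, x₂}, …, {xₘ, x₁}` traversed by the closed walk `x₁, …, xₘ, x₁`. -/
def cyclicEdges (s : List V) : Multiset (Sym2 V) :=
  ((cyclicPairs s).map fun p => s(p.1, p.2) : List (Sym2 V))

/-- Total cost of a multiset of edges. -/
def cost (c : Sym2 V → ℝ) (E : Multiset (Sym2 V)) : ℝ :=
  (E.map c).sum

/-- Degree of a vertex in a (loopless) multigraph. -/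
def degree (E : Multiset (Sym2 V)) (v : V) : ℕ :=
  E.countP (fun e => v ∈ e)

/-- A set of edges, as a multigraph without multiple edges. -/
noncomputable def simpleEdges (S : Set (Sym2 V)) : Multiset (Sym2 V) :=
  S.toFinite.toFinset.val

/-- A Hamiltonian cycle of the complete graph on `V` (where `3 ≤ |V|`), written as the sequence of
its vertices: every vertex occurs exactly once. Its edge set is `cyclicEdges τ`. -/
def IsTour (τ : List V) : Prop :=
  τ.Nodup ∧ ∀ v, v ∈ τ

/-- A Hamiltonian cycle of minimum cost. -/
def IsOptimalTour (c : Sym2 V → ℝ) (τ : List V) : Prop :=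
  IsTour τ ∧ ∀ σ, IsTour σ → cost c (cyclicEdges τ) ≤ cost c (cyclicEdges σ)

/-! ### Violating triangles, bad and good vertices -/

/-- The triangles in which at least one of the three triangle inequalities fails. -/
def violatingTriangles (c : Sym2 V → ℝ) : Set (Finset V) :=
  {T | T.card = 3 ∧ ∃ u v w, T = {u, v, w} ∧ c s(u, w) + c s(w, v) < c s(u, v)}

/-- A vertex is bad if it lies in some violating triangle. -/
def bad (c : Sym2 V → ℝ) : Set V :=
  {v | ∃ T ∈ violatingTriangles c, v ∈ T}

/-- A vertex is good if it is not bad. -/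
def good (c : Sym2 V → ℝ) : Set V :=
  (bad c)ᶜ

/-! ### The branches of the enumeration -/

/-- A branch of the enumeration: a permutation of the bad vertices, cut into consecutive nonempty
pieces, the bad chains `q₁, …, qₜ`. -/
def IsBranch (c : Sym2 V → ℝ) (Q : List (List V)) : Prop :=
  Q.flatten.Nodup ∧ (∀ v, v ∈ Q.flatten ↔ v ∈ bad c) ∧ ∀ q ∈ Q, q ≠ []

/-- The end-vertices `b_e(q₁), …, b_e(qₜ)` of the chains. -/
def chainEnds (Q : List (List V)) : List V :=
  Q.filterMap List.getLast?

/-- The set of end-vertices of the chains. -/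
def roots (Q : List (List V)) : Set V :=
  {v | v ∈ chainEnds Q}

/-- The cycle `C` on the bad vertices: the edges of all chains, together with the edges that join
the end of `qᵢ` to the start of `qᵢ₊₁` cyclically. -/
def badCycle (Q : List (List V)) : Multiset (Sym2 V) :=
  cyclicEdges Q.flatten

/-- The branch `Q` has the order of bad vertices and the gaps of the tour `τ`: up to the choice of
the starting vertex, `τ` is `q₁ p₁ q₂ p₂ … qₜ pₜ` where every `pᵢ` is a nonempty sequence of good
vertices. -/
def Matches (c : Sym2 V → ℝ) (Q : List (List V)) (τ : List V) : Prop :=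
  ∃ P : List (List V), P.length = Q.length ∧ (∀ p ∈ P, p ≠ [] ∧ ∀ v ∈ p, v ∈ good c) ∧
    τ ~r (List.zipWith (fun q p => q ++ p) Q P).flatten

/-! ### The spanning forest and the matching -/

/-- `F` is a spanning forest, rooted at `R`, of the complete graph on `W`: it is acyclic, its edges
lie inside `W`, and the tree of every vertex of `W` contains exactly one vertex of `R`. (So for
`R ⊆ W` the trees are in bijection with `R`. Vertices outside `W` are not part of the forest.) -/
def IsRootedSpanningForest (W R : Set V) (F : SimpleGraph V) : Prop :=
  F.IsAcyclic ∧ (∀ u v, F.Adj u v → u ∈ W ∧ v ∈ W) ∧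
    ∀ v ∈ W, ∃! r, r ∈ R ∧ F.Reachable v r

/-- A rooted spanning forest of minimum cost. -/
def IsRootedMSF (c : Sym2 V → ℝ) (W R : Set V) (F : SimpleGraph V) : Prop :=
  IsRootedSpanningForest W R F ∧ ∀ F', IsRootedSpanningForest W R F' →
    cost c (simpleEdges F.edgeSet) ≤ cost c (simpleEdges F'.edgeSet)

/-- The forests that may be computed in the branch `Q`. -/
def IsBranchForest (c : Sym2 V → ℝ) (Q : List (List V)) (F : SimpleGraph V) : Prop :=
  IsRootedMSF c (good c ∪ roots Q) (roots Q) F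

/-- The graph `G'` that combines the cycle `C` and the forest `F`. -/
noncomputable def cycleForest (Q : List (List V)) (F : SimpleGraph V) : Multiset (Sym2 V) :=
  badCycle Q + simpleEdges F.edgeSet

/-- The vertices of odd degree of a multigraph. -/
def oddVertices (E : Multiset (Sym2 V)) : Set V :=
  {v | Odd (degree E v)}

/-- `M` is a minimum-cost perfect matching of the complete graph on the vertex set `O`. -/
def IsMinPerfectMatching (c : Sym2 V → ℝ) (O : Set V) (M : (⊤ : SimpleGraph V).Subgraph) : Prop :=
  (M.IsMatching ∧ M.verts = O) ∧
    ∀ M' : (⊤ : SimpleGraph V).Subgraph, M'.IsMatching ∧ M'.verts = O →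
      cost c (simpleEdges M.edgeSet) ≤ cost c (simpleEdges M'.edgeSet)

/-- The matchings that may be computed in the branch `Q` after the forest `F`. -/
def IsBranchMatching (c : Sym2 V → ℝ) (Q : List (List V)) (F : SimpleGraph V)
    (M : (⊤ : SimpleGraph V).Subgraph) : Prop :=
  IsMinPerfectMatching c (oddVertices (cycleForest Q F)) M

/-! ### The procedure ShortCut -/

/-- `(a, b)` is a pair of cyclically consecutive chain ends that is joined by a double edge of `H`. -/
def IsDoubleEdge (Q : List (List V)) (H : Multiset (Sym2 V)) (a b : V) : Prop :=
  (a, b) ∈ cyclicPairs (chainEnds Q) ∧ H.count s(a, b) = 2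

/-- One round of the first loop of ShortCut: a double edge `ab` between consecutive chain ends is
made simple, and an edge `ag` with `g` good is replaced by `gb`; if no good vertex is
adjacent to `a`, an edge `bg` with `g` good is replaced by `ga`. -/
inductive ReplaceDouble (c : Sym2 V → ℝ) (Q : List (List V)) :
    Multiset (Sym2 V) → Multiset (Sym2 V) → Prop
  | first (H : Multiset (Sym2 V)) (a b g : V) (hab : IsDoubleEdge Q H a b)
      (hg : g ∈ good c) (hag : s(a, g) ∈ H) :
      ReplaceDouble c Q H (s(g, b) ::ₘ (H.erase s(a, b)).erase s(a, g))
  | second (H : Multiset (Sym2 V)) (a b g : V) (hab : IsDoubleEdge Q H a b)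
      (hno : ∀ x ∈ good c, s(a, x) ∉ H) (hg : g ∈ good c) (hbg : s(b, g) ∈ H) :
      ReplaceDouble c Q H (s(g, a) ::ₘ (H.erase s(a, b)).erase s(b, g))

/-- `s` is the vertex sequence of an Eulerian tour of `H`: the closed walk `s` uses every edge
exactly as often as it occurs in `H`. -/
def IsEulerTour (H : Multiset (Sym2 V)) (s : List V) : Prop :=
  cyclicEdges s = H

/-- One occurrence of a bad vertex `b` that occurs at least twice in the cyclic sequence is
skipped; a cyclic neighbour of this occurrence is good. -/
inductive SkipBad (c : Sym2 V → ℝ) : List V → List V → Prop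
  | skip (l₁ l₂ : List V) (b g : V) (hb : b ∈ bad c) (hrep : b ∈ l₁ ++ l₂) (hg : g ∈ good c)
      (hadj : (l₂ ++ l₁).head? = some g ∨ (l₂ ++ l₁).getLast? = some g) :
      SkipBad c (l₁ ++ b :: l₂) (l₁ ++ l₂)

/-- One occurrence of a good vertex that occurs at least twice in the sequence is skipped. -/
inductive SkipGood (c : Sym2 V → ℝ) : List V → List V → Prop
  | skip (l₁ l₂ : List V) (g : V) (hg : g ∈ good c) (hrep : g ∈ l₁ ++ l₂) :
      SkipGood c (l₁ ++ g :: l₂) (l₁ ++ l₂)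

/-! ### The algorithm

Each branch is a nondeterministic transition system; the nondeterminism covers every
way of breaking ties and of making the choices that the description of the algorithm leaves open. -/

/-- The states of the computation in a branch. -/
inductive State (V : Type*)
  /-- the beginning of the branch -/
  | start : State V
  /-- ShortCut is eliminating the double edges of the multigraph -/
  | doubleEdges (H : Multiset (Sym2 V)) : State V
  /-- ShortCut is skipping repeated bad vertices of the sequence -/
  | badRepeats (s : List V) : State V
  /-- ShortCut is skipping repeated good vertices of the sequence -/
  | goodRepeats (s : List V) : State V
  /-- the branch has ended with this output -/
  | output (s : List V) : State V

/-- The transitions of the computation in the branch `Q`. -/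
inductive BranchStep (c : Sym2 V → ℝ) (Q : List (List V)) : State V → State V → Prop
  /-- without good vertices, the cycle on the bad vertices is output -/
  | trivial (h : good c = ∅) : BranchStep c Q .start (.output Q.flatten)
  /-- compute `F` and `M` and call ShortCut on `H = G' + M` -/
  | build (h : (good c).Nonempty) (F : SimpleGraph V) (M : (⊤ : SimpleGraph V).Subgraph)
      (hF : IsBranchForest c Q F) (hM : IsBranchMatching c Q F M) :
      BranchStep c Q .start (.doubleEdges (cycleForest Q F + simpleEdges M.edgeSet))
  /-- one round of the loop over double edges -/
  | replace (H H' : Multiset (Sym2 V)) (h : ReplaceDouble c Q H H') :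
      BranchStep c Q (.doubleEdges H) (.doubleEdges H')
  /-- when there are no double edges, form an Eulerian tour -/
  | euler (H : Multiset (Sym2 V)) (h : ∀ a b, ¬ IsDoubleEdge Q H a b) (s : List V)
      (hs : IsEulerTour H s) : BranchStep c Q (.doubleEdges H) (.badRepeats s)
  /-- skip a repeated bad vertex -/
  | skipBad (s s' : List V) (h : SkipBad c s s') :
      BranchStep c Q (.badRepeats s) (.badRepeats s')
  /-- all bad vertices are unique -/
  | badUnique (s : List V) (h : ∀ b ∈ bad c, s.count b ≤ 1) :
      BranchStep c Q (.badRepeats s) (.goodRepeats s)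
  /-- skip a repeated good vertex -/
  | skipGood (s s' : List V) (h : SkipGood c s s') :
      BranchStep c Q (.goodRepeats s) (.goodRepeats s')
  /-- all good vertices are unique -/
  | goodUnique (s : List V) (h : ∀ g ∈ good c, s.count g ≤ 1) :
      BranchStep c Q (.goodRepeats s) (.output s)

/-- The state `x` can occur in a computation in the branch `Q`. -/
def Reaches (c : Sym2 V → ℝ) (Q : List (List V)) (x : State V) : Prop :=
  Relation.ReflTransGen (BranchStep c Q) .start x

/-- Every computation in the branch `Q` ends after finitely many transitions. -/
def Terminates (c : Sym2 V → ℝ) (Q : List (List V)) : Prop :=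
  Acc (fun y x => BranchStep c Q x y) .start

/-- No computation in the branch `Q` gets stuck before it has produced an output. -/
def NeverStuck (c : Sym2 V → ℝ) (Q : List (List V)) : Prop :=
  ∀ x, Reaches c Q x → (∃ y, BranchStep c Q x y) ∨ ∃ s, x = .output s

/-- `s` is a possible output of the algorithm: a cheapest one among the outputs `out Q` of the
computations in all branches `Q`. -/
def AlgorithmOutput (c : Sym2 V → ℝ) (s : List V) : Prop :=
  ∃ out : List (List V) → List V,
    (∀ Q, IsBranch c Q → Reaches c Q (.output (out Q))) ∧
    (∃ Q, IsBranch c Q ∧ s = out Q) ∧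
    ∀ Q, IsBranch c Q → cost c (cyclicEdges s) ≤ cost c (cyclicEdges (out Q))

end ParamTSP

open ParamTSP

/-! Every triangle with a good vertex satisfies the triangle inequalities, so a shortcut is free as
soon as one of the three vertices involved is good. The proof arranges that only such shortcuts are
ever needed, both in comparing with a tour and in ShortCut.

In a branch that matches a tour `τ`, three bounds add up to 5/2. The cycle `C` is `τ` with the good
vertices skipped (`cost_badCycle_le`). Hanging each good vertex on its predecessor in `τ`, which is
good or a chain end, gives a rooted spanning forest inside the edges of `τ` (`cost_forest_le`). A
bad vertex of odd degree in `G'` has a forest edge, so it is a chain end and is followed by a good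
vertex in `τ`. Hence restricting `τ` to the odd vertices does not raise the cost, and the resulting
cycle of even length splits into two perfect matchings (`cost_matching_le`).

ShortCut does not get stuck because each bad vertex has at most three edges to bad vertices: two
from `C`, none from `F`, at most one from `M`. This survives every replacement and every skip of a
bad vertex, since each new edge has a good end. If all edges at a chain end with a double edge are
inner, its even degree is at most 3, so the double edge is all it has; by connectivity the other end
then has a good neighbour (`GraphInv.exists_replaceDouble`). A bad vertex occurring twice in the
sequence has degree at least 4, so some occurrence has a good neighbour (`SeqInv.exists_skipBad`).
Termination follows from a lexicographic measure, since each loop shrinks its object.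

Skipping can create loops at good vertices. Costs are therefore tracked with `zeroDiag c`, which
agrees with `c` on loopless multigraphs and satisfies the inequalities for degenerate triangles as
well. -/

namespace ParamTSP

variable {V : Type*}

/-! ### Walks and closed walks as lists -/

/-- The consecutive pairs of a list. -/
def pathPairs (l : List V) : List (V × V) :=
  l.zip l.tail

/-- The edges traversed by the walk that visits the vertices of a list in order. -/
def pathEdges (l : List V) : Multiset (Sym2 V) :=
  ((pathPairs l).map fun p => s(p.1, p.2) : List (Sym2 V))

@[simp] lemma pathPairs_nil : pathPairs ([] : List V) = [] := rfl
@[simp] lemma pathPairs_singleton (x : V) : pathPairs [x] = [] := rfl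
@[simp] lemma pathPairs_cons_cons (x y : V) (l : List V) :
    pathPairs (x :: y :: l) = (x, y) :: pathPairs (y :: l) := rfl
@[simp] lemma pathEdges_singleton (x : V) : pathEdges [x] = 0 := rfl
@[simp] lemma pathEdges_cons_cons (x y : V) (l : List V) :
    pathEdges (x :: y :: l) = s(x, y) ::ₘ pathEdges (y :: l) := rfl
@[simp] lemma cyclicEdges_nil : cyclicEdges ([] : List V) = 0 := rfl

lemma mem_pathPairs {l : List V} {a b : V} :
    (a, b) ∈ pathPairs l ↔ ∃ l₁ l₂, l = l₁ ++ a :: b :: l₂ := by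
  induction l with
  | nil => simp
  | cons x l ih =>
    cases l with
    | nil =>
      simp only [pathPairs_singleton, List.not_mem_nil, false_iff]
      rintro ⟨l₁, l₂, h⟩
      have := congrArg List.length h
      simp at this
      omega
    | cons y l =>
      rw [pathPairs_cons_cons, List.mem_cons, ih]
      constructor
      · rintro (h | ⟨l₁, l₂, h⟩)
        · obtain ⟨rfl, rfl⟩ := Prod.mk.inj h
          exact ⟨[], l, rfl⟩
        · exact ⟨x :: l₁, l₂, by rw [h]; rfl⟩
      · rintro ⟨l₁, l₂, h⟩
        cases l₁ with
        | nil =>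
          simp only [List.nil_append, List.cons.injEq] at h
          exact Or.inl (by rw [h.1, h.2.1])
        | cons z l₁ =>
          simp only [List.cons_append, List.cons.injEq] at h
          exact Or.inr ⟨l₁, l₂, h.2⟩

lemma isChain_iff_pathPairs {R : V → V → Prop} {l : List V} :
    l.IsChain R ↔ ∀ a b, (a, b) ∈ pathPairs l → R a b := by
  rw [List.isChain_iff_forall_rel_of_append_cons_cons]
  constructor
  · intro h a b hab
    obtain ⟨l₁, l₂, hl⟩ := mem_pathPairs.1 hab
    exact h hl
  · intro h a b l₁ l₂ hl
    exact h a b (mem_pathPairs.2 ⟨l₁, l₂, hl⟩)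

lemma pathEdges_append_cons (l₁ : List V) (x : V) (l₂ : List V) :
    pathEdges (l₁ ++ x :: l₂) = pathEdges (l₁ ++ [x]) + pathEdges (x :: l₂) := by
  induction l₁ with
  | nil => simp
  | cons y l ih =>
    cases l with
    | nil => simp
    | cons z l =>
      simp only [List.cons_append, pathEdges_cons_cons, Multiset.cons_add] at ih ⊢
      rw [ih]

lemma cyclicPairs_cons (x : V) (l : List V) :
    cyclicPairs (x :: l) = pathPairs (x :: l ++ [x]) := by
  -- The closing vertex `z` is kept apart from the head `y`, so that the induction can advance the
  -- head.
  suffices h : ∀ (z y : V) (l : List V), (y :: l).zip (l ++ [z]) = pathPairs (y :: l ++ [z]) by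
    simpa [cyclicPairs] using h x x l
  intro z y l
  induction l generalizing y with
  | nil => simp
  | cons w l ih => simpa using ih w

lemma cyclicEdges_cons (x : V) (l : List V) :
    cyclicEdges (x :: l) = pathEdges (x :: l ++ [x]) := by
  rw [cyclicEdges, cyclicPairs_cons, pathEdges]

lemma cyclicPairs_isRotated {l l' : List V} (h : l ~r l') : cyclicPairs l ~r cyclicPairs l' := by
  obtain ⟨n, rfl⟩ := h
  refine ⟨n, ?_⟩
  rw [cyclicPairs, cyclicPairs, List.zip, List.zipWith_rotate_distrib _ _ _ _ (by simp),
    List.rotate_rotate, List.rotate_rotate, add_comm]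

lemma cyclicEdges_isRotated {l l' : List V} (h : l ~r l') : cyclicEdges l = cyclicEdges l' :=
  Multiset.coe_eq_coe.2 ((cyclicPairs_isRotated h).perm.map _)

lemma mem_cyclicPairs_isRotated {l l' : List V} (h : l ~r l') {p : V × V} :
    p ∈ cyclicPairs l ↔ p ∈ cyclicPairs l' :=
  (cyclicPairs_isRotated h).mem_iff

lemma map_fst_cyclicPairs (l : List V) : (cyclicPairs l).map Prod.fst = l :=
  List.map_fst_zip (by simp)

lemma map_snd_cyclicPairs (l : List V) : (cyclicPairs l).map Prod.snd = l.rotate 1 :=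
  List.map_snd_zip (by simp)

lemma card_cyclicEdges (l : List V) : (cyclicEdges l).card = l.length := by
  simp [cyclicEdges, cyclicPairs]

lemma mem_of_mem_cyclicPairs {l : List V} {a b : V} (h : (a, b) ∈ cyclicPairs l) :
    a ∈ l ∧ b ∈ l := by
  have := List.of_mem_zip h
  simpa using this

lemma mem_cyclicEdges {l : List V} {e : Sym2 V} :
    e ∈ cyclicEdges l ↔ ∃ a b, (a, b) ∈ cyclicPairs l ∧ e = s(a, b) := by
  simp [cyclicEdges, eq_comm]

lemma mem_of_mem_cyclicEdges {l : List V} {e : Sym2 V} (h : e ∈ cyclicEdges l) {v : V}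
    (hv : v ∈ e) : v ∈ l := by
  obtain ⟨a, b, hab, rfl⟩ := mem_cyclicEdges.1 h
  have := mem_of_mem_cyclicPairs hab
  rcases Sym2.mem_iff.1 hv with rfl | rfl
  exacts [this.1, this.2]

lemma mem_cyclicEdges_of_append {l₁ l₂ : List V} {a b : V} :
    s(a, b) ∈ cyclicEdges (l₁ ++ a :: b :: l₂) := by
  rw [cyclicEdges_isRotated (List.isRotated_append (l := l₁)), List.cons_append, List.cons_append,
    cyclicEdges_cons]
  simp

lemma cyclicEdges_append_of_head (v : V) (l₁ l₂ : List V) :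
    cyclicEdges (v :: l₁ ++ v :: l₂) = cyclicEdges (v :: l₁) + cyclicEdges (v :: l₂) := by
  have := pathEdges_append_cons (v :: l₁) v (l₂ ++ [v])
  simpa [cyclicEdges_cons] using this

/-- A vertex has a unique successor in a cyclic sequence without repetitions. -/
lemma cyclicPairs_right_unique {l : List V} (hl : l.Nodup) {a b b' : V}
    (h : (a, b) ∈ cyclicPairs l) (h' : (a, b') ∈ cyclicPairs l) : b = b' := by
  have hn : ((cyclicPairs l).map Prod.fst).Nodup := by rwa [map_fst_cyclicPairs]
  have := List.inj_on_of_nodup_map hn h h' rfl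
  exact (Prod.mk.inj this).2

/-- The cyclic pair at a given occurrence, seen from the first vertex. -/
lemma exists_split_of_mem_cyclicPairs {l : List V} {a b : V} (h : (a, b) ∈ cyclicPairs l)
    (hl : l ≠ [a]) : ∃ l₁ l₂, l = l₁ ++ a :: l₂ ∧ (l₂ ++ l₁).head? = some b := by
  cases l with
  | nil => simp [cyclicPairs] at h
  | cons x t =>
    rw [cyclicPairs_cons] at h
    obtain ⟨l₁, l₂, h⟩ := mem_pathPairs.1 h
    -- An empty `l₂` means the closing pair, where `b` is the first vertex `x`; `hl` excludes the
    -- one-vertex list, which leaves no neighbour once `a` is removed.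
    rcases List.eq_nil_or_concat l₂ with rfl | ⟨l₂, y, rfl⟩
    · have h' : (x :: t) ++ [x] = (l₁ ++ [a]) ++ [b] := by simpa using h
      obtain ⟨h1, h2⟩ := List.append_inj' h' rfl
      refine ⟨l₁, [], h1, ?_⟩
      cases l₁ with
      | nil => exact absurd h1 hl
      | cons z l₁ => simp at h1 h2; simp [← h1.1, h2]
    · have h' : (x :: t) ++ [x] = (l₁ ++ a :: b :: l₂) ++ [y] := by simpa using h
      obtain ⟨h1, h2⟩ := List.append_inj' h' rfl
      exact ⟨l₁, b :: l₂, h1, by simp⟩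

/-- The cyclic pair at a given occurrence, seen from the second vertex. -/
lemma exists_split_of_mem_cyclicPairs' {l : List V} {a b : V} (h : (a, b) ∈ cyclicPairs l)
    (hl : l ≠ [b]) : ∃ l₁ l₂, l = l₁ ++ b :: l₂ ∧ (l₂ ++ l₁).getLast? = some a := by
  cases l with
  | nil => simp [cyclicPairs] at h
  | cons x t =>
    rw [cyclicPairs_cons] at h
    obtain ⟨l₁, l₂, h⟩ := mem_pathPairs.1 h
    rcases List.eq_nil_or_concat l₂ with rfl | ⟨l₂, y, rfl⟩
    · have h' : (x :: t) ++ [x] = (l₁ ++ [a]) ++ [b] := by simpa using h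
      obtain ⟨h1, h2⟩ := List.append_inj' h' rfl
      simp only [List.cons.injEq, and_true] at h2
      subst h2
      refine ⟨[], t, rfl, ?_⟩
      cases l₁ with
      | nil => simp at h1; exact absurd (by rw [h1.2]) hl
      | cons z l₁ => simp at h1; simp [h1.2]
    · have h' : (x :: t) ++ [x] = ((l₁ ++ [a]) ++ b :: l₂) ++ [y] := by simpa using h
      obtain ⟨h1, h2⟩ := List.append_inj' h' rfl
      exact ⟨l₁ ++ [a], l₂, h1, by simp⟩

/-- A set that contains a vertex of a cyclic sequence and is closed under successors contains the
whole sequence. -/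
lemma subset_of_closed_cyclicPairs {l : List V} {S : Set V}
    (hS : ∀ a b, (a, b) ∈ cyclicPairs l → a ∈ S → b ∈ S) {v : V} (hv : v ∈ l) (hvS : v ∈ S) :
    ∀ w ∈ l, w ∈ S := by
  obtain ⟨l₁, l₂, rfl⟩ := List.append_of_mem hv
  have hrot : l₁ ++ v :: l₂ ~r v :: l₂ ++ l₁ := List.isRotated_append
  have hS' : ∀ a b, (a, b) ∈ pathPairs (v :: (l₂ ++ l₁)) → a ∈ S → b ∈ S := by
    intro a b hab
    refine hS a b ((mem_cyclicPairs_isRotated hrot).2 ?_)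
    rw [List.cons_append, cyclicPairs_cons]
    obtain ⟨m₁, m₂, h⟩ := mem_pathPairs.1 hab
    exact mem_pathPairs.2 ⟨m₁, m₂ ++ [v], by rw [h]; simp⟩
  have key : ∀ (m : List V) (v : V), v ∈ S →
      (∀ a b, (a, b) ∈ pathPairs (v :: m) → a ∈ S → b ∈ S) → ∀ w ∈ v :: m, w ∈ S := by
    intro m
    induction m with
    | nil => intro v hv _ w hw; simpa [List.mem_singleton.1 hw] using hv
    | cons y m ih =>
      intro v hv h w hw
      rcases List.mem_cons.1 hw with rfl | hw
      · exact hv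
      · exact ih y (h v y (by simp) hv) (fun a b hab => h a b (by simp [hab])) w hw
  intro w hw
  exact key _ v hvS hS' w (by simpa using hrot.mem_iff.1 hw)

lemma not_isDiag_of_mem_cyclicEdges {l : List V} (hl : l.Nodup) (hl2 : 2 ≤ l.length)
    {e : Sym2 V} (he : e ∈ cyclicEdges l) : ¬ e.IsDiag := by
  obtain ⟨a, b, hab, rfl⟩ := mem_cyclicEdges.1 he
  rw [Sym2.mk_isDiag_iff]
  rintro rfl
  obtain ⟨l₁, l₂, rfl, h⟩ := exists_split_of_mem_cyclicPairs hab (by rintro rfl; simp at hl2)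
  have hmem : a ∈ l₂ ++ l₁ := List.mem_of_mem_head? h
  rw [List.nodup_middle] at hl
  exact (List.nodup_cons.1 hl).1 (by simpa [or_comm] using hmem)

/-! ### Degrees -/

section Degree

variable [DecidableEq V]

@[simp] lemma degree_zero (v : V) : degree (0 : Multiset (Sym2 V)) v = 0 := rfl

lemma degree_add (E F : Multiset (Sym2 V)) (v : V) :
    degree (E + F) v = degree E v + degree F v :=
  Multiset.countP_add ..

lemma degree_cons (e : Sym2 V) (E : Multiset (Sym2 V)) (v : V) :
    degree (e ::ₘ E) v = degree E v + if v ∈ e then 1 else 0 := by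
  simp [degree, Multiset.countP_cons]

lemma degree_pos {E : Multiset (Sym2 V)} {v : V} : 0 < degree E v ↔ ∃ w, s(v, w) ∈ E := by
  rw [degree, Multiset.countP_pos]
  constructor
  · rintro ⟨e, he, w, rfl⟩
    exact ⟨w, he⟩
  · rintro ⟨w, h⟩
    exact ⟨_, h, by simp⟩

/-- Each occurrence of `v` starts one step and ends one step. A loop would count for both but only
once in `degree`, hence the hypothesis. -/
lemma degree_cyclicEdges {l : List V} {v : V} (h : s(v, v) ∉ cyclicEdges l) :
    degree (cyclicEdges l) v = 2 * l.count v := by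
  have key : ∀ L : List (V × V), (v, v) ∉ L →
      (L.map fun p => s(p.1, p.2)).countP (fun e => v ∈ e) =
        (L.map Prod.fst).count v + (L.map Prod.snd).count v := by
    intro L
    induction L with
    | nil => simp
    | cons p L ih =>
      intro hL
      obtain ⟨x, y⟩ := p
      simp only [List.mem_cons, not_or] at hL
      simp only [List.map_cons, List.countP_cons, List.count_cons, ih hL.2, Sym2.mem_iff]
      have := hL.1
      grind
  have hv : (v, v) ∉ cyclicPairs l := fun hv => h (mem_cyclicEdges.2 ⟨v, v, hv, rfl⟩)
  have := key _ hv
  rw [map_fst_cyclicPairs, map_snd_cyclicPairs, (List.rotate_perm l 1).count_eq] at this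
  rw [degree, cyclicEdges, Multiset.coe_countP, this, two_mul]

end Degree

end ParamTSP

namespace ParamTSP

variable {V : Type*} [DecidableEq V]

/-! ### Eulerian tours of connected multigraphs with even degrees -/

/-- The multigraph `H` is connected and spans all vertices. -/
def IsConnected (H : Multiset (Sym2 V)) : Prop :=
  ∀ S : Set V, S.Nonempty → (∀ p q, s(p, q) ∈ H → p ∈ S → q ∈ S) → S = Set.univ

/-- Delete an edge `ux`. Unless `x = v`, the odd vertices are then `x` and `v`, and induction on the
number of edges continues the walk from `x`. -/
lemma exists_walk_between_odd (n : ℕ) : ∀ (D : Multiset (Sym2 V)), D.card = n →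
    (∀ e ∈ D, ¬ e.IsDiag) → ∀ u v, u ≠ v → (∀ w, Odd (degree D w) ↔ w = u ∨ w = v) →
    ∃ l : List V, pathEdges (u :: l ++ [v]) ≤ D := by
  induction n with
  | zero =>
    intro D hD _ u v _ h
    rw [Multiset.card_eq_zero] at hD
    simpa [hD] using (h u).2 (Or.inl rfl)
  | succ n ih =>
    intro D hD hdiag u v huv h
    obtain ⟨x, hx⟩ := degree_pos.1 ((h u).2 (Or.inl rfl)).pos
    obtain ⟨D', rfl⟩ := Multiset.exists_cons_of_mem hx
    by_cases hxv : x = v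
    · subst hxv
      exact ⟨[], by simp⟩
    have hux : u ≠ x := by simpa using hdiag _ hx
    have hD' : D'.card = n := by simpa using hD
    obtain ⟨l, hl⟩ := ih D' hD' (fun e he => hdiag e (Multiset.mem_cons_of_mem he)) x v hxv
      (fun w => by
        have := h w
        rw [degree_cons] at this
        simp only [Sym2.mem_iff] at this
        split_ifs at this with hw
        · rw [Nat.odd_add_one] at this
          grind
        · grind)
    exact ⟨x :: l, by simpa using hl⟩

/-- In a multigraph with even degrees there is a closed walk through every nonisolated vertex. -/
lemma exists_closed_walk {D : Multiset (Sym2 V)} (hdiag : ∀ e ∈ D, ¬ e.IsDiag)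
    (heven : ∀ w, Even (degree D w)) {v x : V} (hvx : s(v, x) ∈ D) :
    ∃ l : List V, cyclicEdges (v :: x :: l) ≤ D := by
  obtain ⟨D', rfl⟩ := Multiset.exists_cons_of_mem hvx
  have hxv : v ≠ x := by simpa using hdiag _ hvx
  -- Without the edge `vx` exactly `x` and `v` are odd; a walk between them is closed up by that
  -- edge.
  obtain ⟨l, hl⟩ := exists_walk_between_odd _ D' rfl
    (fun e he => hdiag e (Multiset.mem_cons_of_mem he)) x v hxv.symm (fun w => by
      have := heven w
      rw [degree_cons] at this
      simp only [Sym2.mem_iff] at this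
      split_ifs at this with hw
      · rw [Nat.even_add_one, Nat.not_even_iff_odd] at this
        grind
      · rw [add_zero, ← Nat.not_odd_iff_even] at this
        grind)
  exact ⟨l, by rw [cyclicEdges_cons]; simpa using hl⟩

/-- Hierholzer's argument, by induction on the number `n` of edges not yet used by `t`: the unused
edges have even degrees, so a closed walk among them can be spliced into `t`. -/
lemma exists_isEulerTour_of_le {H : Multiset (Sym2 V)} (hdiag : ∀ e ∈ H, ¬ e.IsDiag)
    (heven : ∀ w, Even (degree H w)) (hconn : IsConnected H) (n : ℕ) :
    ∀ t : List V, cyclicEdges t ≤ H → H.card - t.length = n → ∃ t', IsEulerTour H t' := by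
  induction n using Nat.strong_induction_on with
  | _ n ih =>
    intro t ht hn
    obtain ⟨D, rfl⟩ := Multiset.le_iff_exists_add.1 ht
    by_cases hD0 : D = 0
    · exact ⟨t, by simp [IsEulerTour, hD0]⟩
    have hdiagD : ∀ e ∈ D, ¬ e.IsDiag := fun e he => hdiag e (Multiset.mem_add.2 (Or.inr he))
    have hevenD : ∀ w, Even (degree D w) := by
      intro w
      have h := heven w
      rw [degree_add, degree_cyclicEdges] at h
      · exact (Nat.even_add.1 h).1 (even_two_mul _)
      · exact fun hw => hdiag _ (Multiset.mem_add.2 (Or.inl hw)) (by simp)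
    -- Otherwise the vertices of a nonempty `t` would be closed under all edges of the multigraph
    -- without being all vertices. The alternative `t = []` covers the first round.
    have key : ∃ v x, s(v, x) ∈ D ∧ (t = [] ∨ v ∈ t) := by
      by_contra! hno
      obtain ⟨e, he⟩ := Multiset.exists_mem_of_ne_zero hD0
      induction e with
      | _ p q =>
        obtain ⟨ht0, hpt⟩ := hno p q he
        refine hpt ?_
        have := hconn {v | v ∈ t} (List.exists_mem_of_ne_nil t ht0) (fun a b hab ha => by
          rcases Multiset.mem_add.1 hab with hab | hab
          · exact mem_of_mem_cyclicEdges hab (by simp)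
          · exact absurd ha (hno a b hab).2)
        exact this.ge (Set.mem_univ p)
    obtain ⟨v, x, hvx, hvt⟩ := key
    obtain ⟨l, hl⟩ := exists_closed_walk hdiagD hevenD hvx
    have hcard : l.length + 2 ≤ D.card := by
      simpa [card_cyclicEdges, Nat.lt_iff_add_one_le, add_assoc] using Multiset.card_le_card hl
    rcases hvt with rfl | hvt
    · refine ih _ ?_ (v :: x :: l) (by simpa using hl) rfl
      simp only [cyclicEdges_nil, Multiset.card_add, List.length_cons, Multiset.card_zero,
        List.length_nil] at hn ⊢
      omega
    · obtain ⟨l₁, l₂, rfl⟩ := List.append_of_mem hvt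
      have hrot : cyclicEdges (l₁ ++ v :: l₂) = cyclicEdges (v :: l₂ ++ l₁) :=
        cyclicEdges_isRotated List.isRotated_append
      -- `t` is rotated to start at `v`, where the two closed walks are concatenated.
      refine ih _ ?_ ((v :: x :: l) ++ v :: (l₂ ++ l₁)) ?_ rfl
      · simp only [Multiset.card_add, card_cyclicEdges, List.length_append, List.length_cons]
          at hn ⊢
        omega
      · rw [cyclicEdges_append_of_head, hrot, add_comm]
        exact add_le_add_right hl _

/-- A connected loopless multigraph with even degrees has an Eulerian tour. -/
lemma exists_isEulerTour {H : Multiset (Sym2 V)} (hdiag : ∀ e ∈ H, ¬ e.IsDiag)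
    (heven : ∀ w, Even (degree H w)) (hconn : IsConnected H) : ∃ t, IsEulerTour H t :=
  exists_isEulerTour_of_le hdiag heven hconn _ [] (by simp) rfl

lemma IsConnected.degree_pos [Nontrivial V] {H : Multiset (Sym2 V)} (hconn : IsConnected H)
    (v : V) : 0 < degree H v := by
  rw [ParamTSP.degree_pos]
  by_contra! h
  have := hconn {v} (Set.singleton_nonempty v) (fun p q hpq hp => by
    rw [Set.mem_singleton_iff.1 hp] at hpq
    exact absurd hpq (h q))
  obtain ⟨w, hw⟩ := exists_ne v
  exact hw (this.ge (Set.mem_univ w))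

end ParamTSP

namespace ParamTSP

variable {V : Type*}

/-! ### Costs -/

/-- The cost function, with the value `0` on loops. -/
def zeroDiag [DecidableEq V] (c : Sym2 V → ℝ) : Sym2 V → ℝ :=
  fun e => if e.IsDiag then 0 else c e

/-- The triangle inequality holds whenever one of the three vertices lies in `G`. -/
def TriangleOn (d : Sym2 V → ℝ) (G : Set V) : Prop :=
  ∀ x y z, (x ∈ G ∨ y ∈ G ∨ z ∈ G) → d s(x, z) ≤ d s(x, y) + d s(y, z)

section Cost

variable (d : Sym2 V → ℝ)

@[simp] lemma cost_zero : cost d 0 = 0 := rfl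

@[simp] lemma cost_cons (e : Sym2 V) (E : Multiset (Sym2 V)) :
    cost d (e ::ₘ E) = d e + cost d E := by
  simp [cost]

@[simp] lemma cost_singleton (e : Sym2 V) : cost d {e} = d e := by
  simp [cost]

@[simp] lemma cost_add (E F : Multiset (Sym2 V)) : cost d (E + F) = cost d E + cost d F := by
  simp [cost]

variable {d}

lemma cost_nonneg (hd : ∀ e, 0 ≤ d e) (E : Multiset (Sym2 V)) : 0 ≤ cost d E :=
  Multiset.sum_nonneg (by simpa using fun e _ => hd e)

lemma cost_mono (hd : ∀ e, 0 ≤ d e) {E F : Multiset (Sym2 V)} (h : E ≤ F) :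
    cost d E ≤ cost d F := by
  obtain ⟨D, rfl⟩ := Multiset.le_iff_exists_add.1 h
  rw [cost_add]
  linarith [cost_nonneg hd D]

lemma cost_zeroDiag [DecidableEq V] (c : Sym2 V → ℝ) {E : Multiset (Sym2 V)}
    (h : ∀ e ∈ E, ¬ e.IsDiag) : cost (zeroDiag c) E = cost c E := by
  exact congrArg Multiset.sum (Multiset.map_congr rfl fun e he => if_neg (h e he))

end Cost

lemma zeroDiag_nonneg [DecidableEq V] {c : Sym2 V → ℝ}
    (hc : ∀ e ∈ (⊤ : SimpleGraph V).edgeSet, 0 ≤ c e) (e : Sym2 V) : 0 ≤ zeroDiag c e := by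
  unfold zeroDiag
  split_ifs with h
  · exact le_rfl
  · exact hc e (by simpa [SimpleGraph.edgeSet_top] using h)

/-- For distinct vertices a failure would be a violating triangle, making all three bad. Degenerate
triples need loops of cost 0 and, for `x = z`, nonnegativity. -/
lemma triangleOn_good [DecidableEq V] {c : Sym2 V → ℝ}
    (hc : ∀ e ∈ (⊤ : SimpleGraph V).edgeSet, 0 ≤ c e) : TriangleOn (zeroDiag c) (good c) := by
  intro x y z h
  by_cases hxz : x = z
  · subst hxz
    have h1 := zeroDiag_nonneg hc s(x, y)
    have h2 := zeroDiag_nonneg hc s(y, x)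
    simp only [zeroDiag, Sym2.mk_isDiag_iff] at *
    simp only [if_true]
    linarith
  by_cases hxy : x = y
  · simp [zeroDiag, hxy]
  by_cases hyz : y = z
  · simp [zeroDiag, hyz]
  simp only [zeroDiag, Sym2.mk_isDiag_iff, hxz, hxy, hyz, if_false]
  by_contra! hlt
  have hT : ({x, z, y} : Finset V) ∈ violatingTriangles c :=
    ⟨Finset.card_eq_three.2 ⟨x, z, y, hxz, hxy, Ne.symm hyz, rfl⟩, x, z, y, rfl, hlt⟩
  rcases h with h | h | h <;> exact h ⟨_, hT, by simp⟩

/-! ### Shortcuts under a partial triangle inequality -/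

section Skip

variable {d : Sym2 V → ℝ} {G : Set V}

lemma cost_pathEdges_skip (hd : ∀ e, 0 ≤ d e) (hG : TriangleOn d G) {x y : V}
    (h : x ∈ G ∨ y ∈ G) (l : List V) :
    cost d (pathEdges (x :: l)) ≤ cost d (pathEdges (x :: y :: l)) := by
  cases l with
  | nil => simpa using hd _
  | cons w l =>
    have := hG x y w (by tauto)
    simp only [pathEdges_cons_cons, cost_cons]
    linarith

lemma cost_pathEdges_filter_of_good (hd : ∀ e, 0 ≤ d e) (hG : TriangleOn d G) (p : V → Prop)
    [DecidablePred p] (l : List V) (hp : ∀ y ∈ l, ¬ p y → y ∈ G) (x : V) :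
    cost d (pathEdges (x :: l.filter p)) ≤ cost d (pathEdges (x :: l)) := by
  induction l generalizing x with
  | nil => simp
  | cons y l ih =>
    have ih := ih fun z hz => hp z (List.mem_cons_of_mem _ hz)
    by_cases hy : p y
    · simpa [List.filter_cons, hy] using ih y
    · rw [List.filter_cons_of_neg (by simpa using hy)]
      exact (ih x).trans (cost_pathEdges_skip hd hG (Or.inr (hp y (by simp) hy)) l)

/-- Only vertices outside `G` are skipped here. By the chain condition the kept vertex `x` before a
skipped `y` lies in `G`, which makes the skip free; and as `x ∈ G`, the condition for its new
successor is vacuous. -/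
lemma cost_pathEdges_filter_of_chain (hd : ∀ e, 0 ≤ d e) (hG : TriangleOn d G) (p : V → Prop)
    [DecidablePred p] (hp : ∀ g ∈ G, p g) (l : List V) (x : V) (hx : p x)
    (hl : (x :: l).IsChain fun a b => p a → a ∉ G → b ∈ G) :
    cost d (pathEdges (x :: l.filter p)) ≤ cost d (pathEdges (x :: l)) := by
  induction l generalizing x with
  | nil => simp
  | cons y l ih =>
    rw [List.isChain_cons_cons] at hl
    by_cases hy : p y
    · simpa [List.filter_cons, hy] using ih y hy hl.2
    · have hyG : y ∉ G := fun h => hy (hp y h)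
      have hxG : x ∈ G := by
        by_contra h
        exact hyG (hl.1 hx h)
      rw [List.filter_cons_of_neg (by simpa using hy)]
      refine (ih x hx ?_).trans (cost_pathEdges_skip hd hG (Or.inl hxG) l)
      cases l with
      | nil => simp
      | cons w l => exact List.isChain_cons_cons.2 ⟨fun _ h => absurd hxG h, hl.2.tail⟩

lemma exists_isRotated_filter (p : V → Prop) [DecidablePred p] {l : List V} {x : V} (hx : x ∈ l)
    (hpx : p x) : ∃ m : List V, l ~r x :: m ∧ l.filter p ~r x :: m.filter p := by
  obtain ⟨l₁, l₂, rfl⟩ := List.append_of_mem hx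
  refine ⟨l₂ ++ l₁, List.isRotated_append, ?_⟩
  simp only [List.filter_append, List.filter_cons_of_pos (p := fun v => decide (p v)) (a := x)
    (l := l₂) (by simpa using hpx)]
  exact List.isRotated_append

/-- The closing copy of `x` survives the filter, which reduces closed sequences to the open case. -/
lemma cyclicEdges_filter_cons (p : V → Prop) [DecidablePred p] {x : V} (hpx : p x) (m : List V) :
    cyclicEdges (x :: m.filter p) = pathEdges (x :: (m ++ [x]).filter p) := by
  rw [cyclicEdges_cons]
  simp [hpx]

/-- Skipping vertices of `G` does not make a cyclic sequence more expensive. -/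
lemma cost_cyclicEdges_filter_of_good (hd : ∀ e, 0 ≤ d e) (hG : TriangleOn d G) (p : V → Prop)
    [DecidablePred p] (l : List V) (hp : ∀ y ∈ l, ¬ p y → y ∈ G) :
    cost d (cyclicEdges (l.filter p)) ≤ cost d (cyclicEdges l) := by
  by_cases hx : ∃ x ∈ l, p x
  · obtain ⟨x, hx, hpx⟩ := hx
    obtain ⟨m, h1, h2⟩ := exists_isRotated_filter p hx hpx
    rw [cyclicEdges_isRotated h1, cyclicEdges_isRotated h2, cyclicEdges_filter_cons p hpx,
      cyclicEdges_cons]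
    refine cost_pathEdges_filter_of_good hd hG p _ (fun y hy => hp y (h1.mem_iff.2 ?_)) x
    simpa [or_comm] using hy
  · rw [List.filter_eq_nil_iff.2 fun x hxl => by simpa using fun h => hx ⟨x, hxl, h⟩]
    simpa using cost_nonneg hd _

lemma cost_cyclicEdges_filter_of_chain (hd : ∀ e, 0 ≤ d e) (hG : TriangleOn d G) (p : V → Prop)
    [DecidablePred p] (hp : ∀ g ∈ G, p g) (l : List V)
    (hl : ∀ a b, (a, b) ∈ cyclicPairs l → p a → a ∉ G → b ∈ G) :
    cost d (cyclicEdges (l.filter p)) ≤ cost d (cyclicEdges l) := by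
  by_cases hx : ∃ x ∈ l, p x
  · obtain ⟨x, hx, hpx⟩ := hx
    obtain ⟨m, h1, h2⟩ := exists_isRotated_filter p hx hpx
    rw [cyclicEdges_isRotated h1, cyclicEdges_isRotated h2, cyclicEdges_filter_cons p hpx,
      cyclicEdges_cons]
    refine cost_pathEdges_filter_of_chain hd hG p hp _ x hpx (isChain_iff_pathPairs.2 ?_)
    intro a b hab
    refine hl a b ((mem_cyclicPairs_isRotated h1).2 ?_)
    rwa [cyclicPairs_cons]
  · rw [List.filter_eq_nil_iff.2 fun x hxl => by simpa using fun h => hx ⟨x, hxl, h⟩]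
    simpa using cost_nonneg hd _

/-- Restricting a cyclic sequence to a vertex set `O` does not make it more expensive, provided
that every vertex of `O` outside `G` is followed by a vertex of `G`. -/
lemma cost_cyclicEdges_filter (hd : ∀ e, 0 ≤ d e) (hG : TriangleOn d G) (p : V → Prop)
    [DecidablePred p] (l : List V)
    (hl : ∀ a b, (a, b) ∈ cyclicPairs l → p a → a ∉ G → b ∈ G) :
    cost d (cyclicEdges (l.filter p)) ≤ cost d (cyclicEdges l) := by
  classical
  -- The order of the two rounds matters: unwanted vertices outside `G` go first, while every kept
  -- vertex outside `G` is still followed by one of `G`. After that only vertices of `G` remain to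
  -- be skipped.
  have h1 := cost_cyclicEdges_filter_of_chain hd hG (fun v => v ∈ G ∨ p v)
    (fun g hg => Or.inl hg) l (fun a b hab ha haG => hl a b hab (ha.resolve_left haG) haG)
  have h2 := cost_cyclicEdges_filter_of_good hd hG p (l.filter fun v => v ∈ G ∨ p v)
    (fun y hy hpy => by simpa [hpy] using (List.mem_filter.1 hy).2)
  have h3 : (l.filter fun v => v ∈ G ∨ p v).filter p = l.filter p := by
    rw [List.filter_filter]
    refine List.filter_congr fun v _ => ?_
    by_cases hv : p v <;> simp [hv]
  rw [h3] at h2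
  exact h2.trans h1

lemma cyclicEdges_eq_pathEdges_add {m : List V} {x y : V} (hx : m.head? = some x)
    (hy : m.getLast? = some y) : cyclicEdges m = s(y, x) ::ₘ pathEdges m := by
  obtain ⟨m, rfl⟩ := List.head?_eq_some_iff.1 hx
  rw [cyclicEdges_cons]
  obtain ⟨m', h⟩ := List.getLast?_eq_some_iff.1 hy
  rw [h, List.append_assoc]
  have := pathEdges_append_cons m' y [x]
  simp only [pathEdges_cons_cons, pathEdges_singleton] at this
  rw [List.singleton_append, this, add_comm]
  rfl

/-- The effect of skipping one vertex of a cyclic sequence. -/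
lemma exists_cyclicEdges_skip (l₁ l₂ : List V) (b : V) (h : l₁ ++ l₂ ≠ []) :
    ∃ x y E, (l₂ ++ l₁).head? = some x ∧ (l₂ ++ l₁).getLast? = some y ∧
      cyclicEdges (l₁ ++ b :: l₂) = s(b, x) ::ₘ s(y, b) ::ₘ E ∧
      cyclicEdges (l₁ ++ l₂) = s(y, x) ::ₘ E := by
  have h' : l₂ ++ l₁ ≠ [] := by simpa [and_comm] using h
  obtain ⟨x, hx⟩ : ∃ x, (l₂ ++ l₁).head? = some x := ⟨_, List.head?_eq_some_head h'⟩
  obtain ⟨y, hy⟩ : ∃ y, (l₂ ++ l₁).getLast? = some y := ⟨_, List.getLast?_eq_some_getLast h'⟩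
  refine ⟨x, y, pathEdges (l₂ ++ l₁), hx, hy, ?_, ?_⟩
  · rw [cyclicEdges_isRotated (List.isRotated_append (l := l₁)), List.cons_append,
      cyclicEdges_eq_pathEdges_add (x := b) (y := y) (by simp)
        (by rw [List.getLast?_cons, hy]; rfl), Multiset.cons_swap]
    congr 1
    obtain ⟨m, hm⟩ := List.head?_eq_some_iff.1 hx
    rw [hm, pathEdges_cons_cons]
  · rw [cyclicEdges_isRotated (List.isRotated_append (l := l₁)),
      cyclicEdges_eq_pathEdges_add hx hy]

/-- Triangle inequality for the two neighbours `y`, `x` and the skipped `b`. The case `x = y` is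
allowed and creates a loop. -/
lemma cost_cyclicEdges_skip (hG : TriangleOn d G) {l₁ l₂ : List V}
    {b : V} (hne : l₁ ++ l₂ ≠ [])
    (h : b ∈ G ∨ ∃ g ∈ G, (l₂ ++ l₁).head? = some g ∨ (l₂ ++ l₁).getLast? = some g) :
    cost d (cyclicEdges (l₁ ++ l₂)) ≤ cost d (cyclicEdges (l₁ ++ b :: l₂)) := by
  obtain ⟨x, y, E, hx, hy, h1, h2⟩ := exists_cyclicEdges_skip l₁ l₂ b hne
  have := hG y b x (by
    rcases h with h | ⟨g, hg, h | h⟩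
    · exact Or.inr (Or.inl h)
    · rw [hx] at h
      exact Or.inr (Or.inr (Option.some.inj h ▸ hg))
    · rw [hy] at h
      exact Or.inl (Option.some.inj h ▸ hg))
  rw [h1, h2]
  simp only [cost_cons]
  linarith

end Skip

end ParamTSP

namespace ParamTSP

variable {V : Type*}

/-! ### Edge sets as multisets -/

section Simple

variable [Fintype V]

@[simp] lemma mem_simpleEdges {S : Set (Sym2 V)} {e : Sym2 V} : e ∈ simpleEdges S ↔ e ∈ S := by
  simp [simpleEdges]

lemma nodup_simpleEdges (S : Set (Sym2 V)) : (simpleEdges S).Nodup :=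
  S.toFinite.toFinset.nodup

lemma simpleEdges_le {S : Set (Sym2 V)} {E : Multiset (Sym2 V)} (h : ∀ e ∈ S, e ∈ E) :
    simpleEdges S ≤ E :=
  (Multiset.le_iff_subset (nodup_simpleEdges S)).2 fun e he => h e (mem_simpleEdges.1 he)

end Simple

/-! ### Rooted forests given by parent functions -/

section Forest

/-- The graph that joins every vertex of `G` to its parent. -/
def parentGraph (G : Set V) (f : V → V) : SimpleGraph V :=
  SimpleGraph.fromRel fun u v => u ∈ G ∧ v = f u

variable {G R : Set V} {f : V → V} {rank : V → ℕ}

lemma parentGraph_adj (hrank : ∀ v ∈ G, rank (f v) < rank v) {u v : V} :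
    (parentGraph G f).Adj u v ↔ (u ∈ G ∧ v = f u) ∨ (v ∈ G ∧ u = f v) := by
  rw [parentGraph, SimpleGraph.fromRel_adj, and_iff_right_iff_imp]
  rintro (⟨h, h'⟩ | ⟨h, h'⟩) rfl
  · have := hrank u h
    rw [← h'] at this
    exact this.false
  · have := hrank u h
    rw [← h'] at this
    exact this.false

/-- On a cycle, a vertex of maximal rank could only have its parent as neighbour, on both sides. -/
lemma parentGraph_isAcyclic (hrank : ∀ v ∈ G, rank (f v) < rank v) :
    (parentGraph G f).IsAcyclic := by
  classical
  intro v p hp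
  obtain ⟨w, hw, hmax⟩ := p.support.toFinset.exists_max_image rank ⟨v, by simp⟩
  rw [List.mem_toFinset] at hw
  have hq : (p.rotate w hw).IsCycle := hp.rotate hw
  have key : ∀ u, (parentGraph G f).Adj w u → u ∈ p.support → u = f w := by
    intro u hu hup
    rcases (parentGraph_adj hrank).1 hu with h | h
    · exact h.2
    · have h1 := hrank u h.1
      have h2 := hmax u (List.mem_toFinset.2 hup)
      rw [← h.2] at h1
      omega
  refine hq.snd_ne_penultimate ?_
  rw [key _ (SimpleGraph.Walk.adj_snd hq.not_nil)
      ((SimpleGraph.Walk.mem_support_rotate_iff p w hw).1 (SimpleGraph.Walk.getVert_mem_support _ _)),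
    key _ (SimpleGraph.Walk.adj_penultimate hq.not_nil).symm
      ((SimpleGraph.Walk.mem_support_rotate_iff p w hw).1 (SimpleGraph.Walk.getVert_mem_support _ _))]

/-- A parent function that decreases a rank and stays inside `G ∪ R` yields a spanning forest
rooted at `R`. -/
lemma isRootedSpanningForest_parentGraph [Finite V] (hGR : ∀ v ∈ R, v ∉ G)
    (hrank : ∀ v ∈ G, rank (f v) < rank v) (hf : ∀ v ∈ G, f v ∈ G ∪ R) :
    IsRootedSpanningForest (G ∪ R) R (parentGraph G f) := by
  classical
  refine ⟨parentGraph_isAcyclic hrank, ?_, ?_⟩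
  · intro u v huv
    rcases (parentGraph_adj hrank).1 huv with ⟨h, rfl⟩ | ⟨h, rfl⟩
    exacts [⟨Or.inl h, hf u h⟩, ⟨hf v h, Or.inl h⟩]
  have hex : ∀ n, ∀ v ∈ G ∪ R, rank v = n → ∃ r ∈ R, (parentGraph G f).Reachable v r := by
    intro n
    induction n using Nat.strong_induction_on with
    | _ n ih =>
      rintro v (hv | hv) hn
      · obtain ⟨r, hr, hvr⟩ := ih (rank (f v)) (hn ▸ hrank v hv) (f v) (hf v hv) rfl
        exact ⟨r, hr,
          (SimpleGraph.Adj.reachable ((parentGraph_adj hrank).2 (Or.inl ⟨hv, rfl⟩))).trans hvr⟩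
      · exact ⟨v, hv, SimpleGraph.Reachable.refl v⟩
  -- Uniqueness of the root: `g` climbs to the parent inside `G` and rests outside. Iterated more
  -- often than any rank it leaves `G`, is constant on components and fixes the roots.
  let g : V → V := fun v => if v ∈ G then f v else v
  have hg : ∀ n v, g^[n] v ∉ G ∨ rank (g^[n] v) + n ≤ rank v := by
    intro n v
    induction n with
    | zero => simp
    | succ n ih =>
      rw [Function.iterate_succ_apply']
      by_cases h : g^[n] v ∈ G
      · have h1 := hrank _ h
        have h2 := ih.resolve_left (not_not.2 h)
        right
        simp only [g, h, if_true] at h1 h2 ⊢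
        omega
      · left
        simp [g, h]
  obtain ⟨N, hN⟩ : ∃ N, ∀ v, rank v < N := by
    obtain ⟨N, hN⟩ := (Set.finite_range rank).bddAbove
    exact ⟨N + 1, fun v => Nat.lt_succ_of_le (hN ⟨v, rfl⟩)⟩
  have hfix : ∀ v, g^[N] v ∉ G := by
    intro v
    rcases hg N v with h | h
    · exact h
    · have := hN v
      omega
  have hadj : ∀ u v, (parentGraph G f).Adj u v → g^[N] u = g^[N] v := by
    have : ∀ u ∈ G, g^[N] u = g^[N] (f u) := by
      intro u hu
      have h1 : f u = g u := by simp [g, hu]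
      rw [h1, ← Function.iterate_succ_apply, Function.iterate_succ_apply']
      simp [g, hfix u]
    intro u v huv
    rcases (parentGraph_adj hrank).1 huv with ⟨h, rfl⟩ | ⟨h, rfl⟩
    exacts [this u h, (this v h).symm]
  have hroot : ∀ r ∈ R, g^[N] r = r := fun r hr =>
    Function.iterate_fixed (by simp [g, hGR r hr]) N
  have hreach : ∀ u v, (parentGraph G f).Reachable u v → g^[N] u = g^[N] v := by
    rintro u v ⟨p⟩
    induction p with
    | nil => rfl
    | cons h _ ih => exact (hadj _ _ h).trans ih
  intro v hv
  obtain ⟨r, hr, hvr⟩ := hex _ v hv rfl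
  refine ⟨r, ⟨hr, hvr⟩, ?_⟩
  rintro r' ⟨hr', hvr'⟩
  rw [← hroot r hr, ← hroot r' hr', ← hreach _ _ hvr, ← hreach _ _ hvr']

lemma exists_isRootedMSF [Fintype V] [DecidableEq V] (c : Sym2 V → ℝ) {W : Set V}
    (h : ∃ F, IsRootedSpanningForest W R F) : ∃ F, IsRootedMSF c W R F := by
  obtain ⟨F, hF, hmin⟩ := Set.exists_min_image {F | IsRootedSpanningForest W R F}
    (fun F => cost c (simpleEdges F.edgeSet)) (Set.toFinite _) h
  exact ⟨F, hF, hmin⟩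

/-- Distinct roots of a rooted forest are not adjacent. -/
lemma IsRootedSpanningForest.not_adj {W : Set V} {F : SimpleGraph V}
    (hF : IsRootedSpanningForest W R F) {r r' : V} (hr : r ∈ R) (hr' : r' ∈ R) : ¬ F.Adj r r' := by
  intro h
  obtain ⟨x, -, hx⟩ := hF.2.2 r (hF.2.1 _ _ h).1
  exact h.ne ((hx r ⟨hr, SimpleGraph.Reachable.refl r⟩).trans (hx r' ⟨hr', h.reachable⟩).symm)

end Forest

/-! ### Matchings on the vertices of a list -/

section Matching

/-- The edges that join the first and the second, the third and the fourth, … vertex of a list. -/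
def pairEdges : List V → Multiset (Sym2 V)
  | x :: y :: l => s(x, y) ::ₘ pairEdges l
  | _ => 0

/-- The edges of a walk alternate between the pairing starting at its first vertex and the one
starting at its second. -/
lemma pathEdges_cons_eq_pairEdges (x : V) (l : List V) :
    pathEdges (x :: l) = pairEdges (x :: l) + pairEdges l := by
  induction l generalizing x with
  | nil => simp [pairEdges]
  | cons y l ih =>
    rw [pathEdges_cons_cons, ih, pairEdges, Multiset.cons_add, add_comm]

lemma pairEdges_append_singleton : ∀ (l : List V) (z : V), Even l.length →
    pairEdges (l ++ [z]) = pairEdges l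
  | [], _, _ => rfl
  | [_], _, h => by simp at h
  | x :: y :: l, z, h => by
    have h' : Even l.length := by simpa [Nat.even_add_one, Nat.even_add] using h
    simp [pairEdges, pairEdges_append_singleton l z h']

/-- The edges of a closed walk of even length split into two perfect matchings. -/
lemma cyclicEdges_eq_pairEdges_add (x : V) (l : List V) (h : Even (x :: l).length) :
    cyclicEdges (x :: l) = pairEdges (x :: l) + pairEdges (l ++ [x]) := by
  rw [cyclicEdges_cons, List.cons_append, pathEdges_cons_eq_pairEdges, ← List.cons_append,
    pairEdges_append_singleton _ _ h]

/-- Containment of the edges in `pairEdges l` is enough for cost bounds, as costs will be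
nonnegative. -/
lemma exists_isMatching_of_list : ∀ l : List V, l.Nodup → Even l.length →
    ∃ M : (⊤ : SimpleGraph V).Subgraph, M.IsMatching ∧ M.verts = {v | v ∈ l} ∧
      ∀ e ∈ M.edgeSet, e ∈ pairEdges l
  | [], _, _ => ⟨⊥, by simp [SimpleGraph.Subgraph.IsMatching], by simp, by simp⟩
  | [_], _, h => by simp at h
  | x :: y :: l, hl, h => by
    have h' : Even l.length := by simpa [Nat.even_add_one, Nat.even_add] using h
    simp only [List.nodup_cons, List.mem_cons, not_or] at hl
    obtain ⟨M, hM, hv, he⟩ := exists_isMatching_of_list l hl.2.2 h'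
    have hxy : (⊤ : SimpleGraph V).Adj x y := hl.1.1
    refine ⟨M ⊔ (⊤ : SimpleGraph V).subgraphOfAdj hxy,
      hM.sup (SimpleGraph.Subgraph.IsMatching.subgraphOfAdj hxy) ?_, ?_, ?_⟩
    · rw [hM.support_eq_verts, (SimpleGraph.Subgraph.IsMatching.subgraphOfAdj hxy).support_eq_verts,
        hv, SimpleGraph.subgraphOfAdj_verts, Set.disjoint_left]
      rintro v hv (rfl | rfl)
      exacts [hl.1.2 hv, hl.2.1 hv]
    · ext v
      simp [hv]
    · intro e
      rw [SimpleGraph.Subgraph.edgeSet_sup, SimpleGraph.edgeSet_subgraphOfAdj, pairEdges,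
        Multiset.mem_cons]
      rintro (h | h)
      exacts [Or.inr (he e h), Or.inl h]

variable [Fintype V]

lemma exists_isMinPerfectMatching (c : Sym2 V → ℝ) {O : Set V} (hO : Even O.ncard) :
    ∃ M, IsMinPerfectMatching c O M := by
  classical
  obtain ⟨M, hM⟩ : ∃ M : (⊤ : SimpleGraph V).Subgraph, M.IsMatching ∧ M.verts = O := by
    obtain ⟨M, h, hv, -⟩ := exists_isMatching_of_list O.toFinset.toList (Finset.nodup_toList _)
      (by rwa [Finset.length_toList, ← Set.ncard_eq_toFinset_card'])
    exact ⟨M, h, by simpa using hv⟩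
  obtain ⟨M, hM, hmin⟩ := Set.exists_min_image
    {M : (⊤ : SimpleGraph V).Subgraph | M.IsMatching ∧ M.verts = O}
    (fun M => cost c (simpleEdges M.edgeSet)) (Set.toFinite _) ⟨M, hM⟩
  exact ⟨M, hM, hmin⟩

/-- A minimum perfect matching costs at most half as much as a cycle on its vertices. -/
lemma IsMinPerfectMatching.two_mul_cost_le {d : Sym2 V → ℝ} (hd : ∀ e, 0 ≤ d e) {O : Set V}
    {M : (⊤ : SimpleGraph V).Subgraph} (hM : IsMinPerfectMatching d O M) {l : List V}
    (hl : l.Nodup) (hlO : ∀ v, v ∈ l ↔ v ∈ O) (heven : Even l.length) :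
    2 * cost d (simpleEdges M.edgeSet) ≤ cost d (cyclicEdges l) := by
  have key : ∀ m : List V, m.Nodup → (∀ v, v ∈ m ↔ v ∈ O) → Even m.length →
      cost d (simpleEdges M.edgeSet) ≤ cost d (pairEdges m) := by
    intro m hm hmO hme
    obtain ⟨M', h, hv, he⟩ := exists_isMatching_of_list m hm hme
    exact (hM.2 M' ⟨h, by rw [hv]; ext v; exact hmO v⟩).trans (cost_mono hd (simpleEdges_le he))
  cases l with
  | nil => simpa [two_mul, pairEdges] using add_le_add (key [] hl hlO heven) (key [] hl hlO heven)
  | cons x l =>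
    -- The second matching pairs up the list rotated by one; both matchings cost at least as much as
    -- `M`.
    have hrot : x :: l ~r l ++ [x] := List.isRotated_append (l := [x])
    rw [cyclicEdges_eq_pairEdges_add x l heven, cost_add, two_mul]
    refine add_le_add (key _ hl hlO heven) (key _ (hrot.nodup_iff.1 hl) (fun v => ?_) ?_)
    · rw [← hrot.mem_iff, hlO]
    · simpa using heven

variable [DecidableEq V]

lemma degree_simpleEdges_of_isMatching {M : (⊤ : SimpleGraph V).Subgraph} (hM : M.IsMatching)
    (v : V) [Decidable (v ∈ M.verts)] :
    degree (simpleEdges M.edgeSet) v = if v ∈ M.verts then 1 else 0 := by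
  have hmem : ∀ e : Sym2 V, e ∈ (simpleEdges M.edgeSet).filter (fun e => v ∈ e) ↔
      ∃ w, M.Adj v w ∧ e = s(v, w) := by
    intro e
    rw [Multiset.mem_filter, mem_simpleEdges]
    constructor
    · rintro ⟨he, w, rfl⟩
      exact ⟨w, he, rfl⟩
    · rintro ⟨w, hw, rfl⟩
      exact ⟨hw, by simp⟩
  have hnodup := (nodup_simpleEdges M.edgeSet).filter (fun e => v ∈ e)
  rw [degree, Multiset.countP_eq_card_filter]
  split_ifs with hv
  · obtain ⟨w, hw, huniq⟩ := hM hv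
    have : (simpleEdges M.edgeSet).filter (fun e => v ∈ e) = {s(v, w)} := by
      refine (Multiset.Nodup.ext hnodup (Multiset.nodup_singleton _)).2 fun e => ?_
      rw [hmem, Multiset.mem_singleton]
      constructor
      · rintro ⟨u, hu, rfl⟩
        rw [huniq u hu]
      · rintro rfl
        exact ⟨w, hw, rfl⟩
    rw [this, Multiset.card_singleton]
  · rw [Multiset.card_eq_zero, Multiset.eq_zero_iff_forall_notMem]
    intro e he
    obtain ⟨w, hw, -⟩ := (hmem e).1 he
    exact hv (M.edge_vert hw)

/-- A multigraph without loops has an even number of vertices of odd degree. -/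
lemma even_ncard_oddVertices {E : Multiset (Sym2 V)} (hE : ∀ e ∈ E, ¬ e.IsDiag) :
    Even (oddVertices E).ncard := by
  classical
  have hsum : ∑ v, degree E v = 2 * E.card := by
    induction E using Multiset.induction with
    | empty => simp
    | cons e E ih =>
      have hdiag := hE e (Multiset.mem_cons_self _ _)
      simp only [degree_cons, Finset.sum_add_distrib,
        ih fun e he => hE e (Multiset.mem_cons_of_mem he), Multiset.card_cons]
      have : (∑ v, if v ∈ e then 1 else 0) = 2 := by
        induction e with
        | _ x y =>
          rw [Sym2.mk_isDiag_iff] at hdiag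
          rw [Finset.sum_boole, ← Finset.card_pair hdiag]
          simp only [Nat.cast_id]
          congr 1
          ext v
          simp
      omega
  have := (Finset.even_sum_iff_even_card_odd (s := Finset.univ) (degree E)).1
    (hsum ▸ even_two_mul _)
  rwa [Set.ncard_eq_toFinset_card', oddVertices, Set.toFinset_ofPred]

end Matching

end ParamTSP

namespace ParamTSP

variable {V : Type*}

/-! ### Edges inside a vertex set -/

/-- `e` is an edge at `b` with both ends in `B`. -/
def IsInnerEdge (B : Set V) (b : V) (e : Sym2 V) : Prop :=
  b ∈ e ∧ ∀ x ∈ e, x ∈ B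

noncomputable instance (B : Set V) (b : V) : DecidablePred (IsInnerEdge B b) :=
  Classical.decPred _

/-- The number of edges at `b` with both ends in `B`. -/
noncomputable def innerDegree (B : Set V) (E : Multiset (Sym2 V)) (b : V) : ℕ :=
  E.countP (IsInnerEdge B b)

section InnerDegree

variable {B : Set V} {E F : Multiset (Sym2 V)} {b : V}

lemma innerDegree_add : innerDegree B (E + F) b = innerDegree B E b + innerDegree B F b :=
  Multiset.countP_add ..

lemma innerDegree_mono (h : E ≤ F) : innerDegree B E b ≤ innerDegree B F b :=
  Multiset.countP_le_of_le _ h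

lemma innerDegree_cons_of_notMem {e : Sym2 V} {x : V} (hx : x ∈ e) (hxB : x ∉ B) :
    innerDegree B (e ::ₘ E) b = innerDegree B E b :=
  Multiset.countP_cons_of_neg _ fun h => hxB (h.2 x hx)

variable [DecidableEq V]

lemma innerDegree_le_degree : innerDegree B E b ≤ degree E b := by
  rw [innerDegree, degree, Multiset.countP_eq_card_filter, Multiset.countP_eq_card_filter]
  exact Multiset.card_le_card (Multiset.monotone_filter_right _ fun e he => he.1)

lemma innerDegree_eq_degree (h : ∀ x, s(b, x) ∈ E → x ∈ B) (hb : b ∈ B) :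
    innerDegree B E b = degree E b := by
  refine Multiset.countP_congr rfl fun e he => ?_
  rw [eq_iff_iff, IsInnerEdge, and_iff_left_iff_imp]
  rintro ⟨x, rfl⟩ y hy
  rcases Sym2.mem_iff.1 hy with rfl | rfl
  exacts [hb, h _ he]

end InnerDegree

variable [DecidableEq V] {c : Sym2 V → ℝ} {Q : List (List V)}

/-! ### The multigraphs of the first loop -/

/-- The invariant of the loop over double edges. -/
structure GraphInv (c : Sym2 V → ℝ) (H : Multiset (Sym2 V)) : Prop where
  loopless : ∀ e ∈ H, ¬ e.IsDiag
  even : ∀ v, Even (degree H v)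
  connected : IsConnected H
  inner : ∀ b ∈ bad c, innerDegree (bad c) H b ≤ 3

lemma mem_bad_of_mem_chainEnds (hQ : IsBranch c Q) {a : V} (ha : a ∈ chainEnds Q) :
    a ∈ bad c := by
  obtain ⟨q, hq, hqa⟩ := List.mem_filterMap.1 ha
  exact (hQ.2.1 a).1 (List.mem_flatten.2 ⟨q, hq, List.mem_of_getLast? hqa⟩)

lemma IsDoubleEdge.mem_bad {H : Multiset (Sym2 V)} {a b : V} (hQ : IsBranch c Q)
    (h : IsDoubleEdge Q H a b) : a ∈ bad c ∧ b ∈ bad c :=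
  ⟨mem_bad_of_mem_chainEnds hQ (mem_of_mem_cyclicPairs h.1).1,
    mem_bad_of_mem_chainEnds hQ (mem_of_mem_cyclicPairs h.1).2⟩

lemma exists_eq_cons_cons_of_count {H : Multiset (Sym2 V)} {e : Sym2 V} (h : H.count e = 2) :
    ∃ E, H = e ::ₘ e ::ₘ E := by
  obtain ⟨E, hE⟩ := Multiset.le_iff_exists_add.1 (Multiset.le_count_iff_replicate_le.1 h.ge)
  exact ⟨E, by rw [hE]; simp [Multiset.replicate_succ]⟩

/-- Covers both cases of `ReplaceDouble`, the second with `a` and `b` exchanged. The degree of `a`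
drops by 2 and the others are unchanged; the new edge `gb` is not inner because `g` is good, and it
costs at most `ga` plus the deleted copy of `ab`. -/
lemma GraphInv.replace {H : Multiset (Sym2 V)} (hH : GraphInv c H) {a b g : V} (ha : a ∈ bad c)
    (hb : b ∈ bad c) (hg : g ∈ good c) (hab : H.count s(a, b) = 2) (hag : s(a, g) ∈ H) :
    GraphInv c (s(g, b) ::ₘ (H.erase s(a, b)).erase s(a, g)) ∧
      ∀ d : Sym2 V → ℝ, (∀ e, 0 ≤ d e) → TriangleOn d (good c) →
        cost d (s(g, b) ::ₘ (H.erase s(a, b)).erase s(a, g)) ≤ cost d H := by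
  have hag' : a ≠ g := fun h => hg (h ▸ ha)
  have hbg' : b ≠ g := fun h => hg (h ▸ hb)
  obtain ⟨E, rfl⟩ := exists_eq_cons_cons_of_count hab
  have hE : s(a, g) ∈ E := by simpa [hbg'.symm, hag'.symm] using hag
  obtain ⟨E, rfl⟩ := Multiset.exists_cons_of_mem hE
  have hab' : a ≠ b := by simpa using hH.loopless s(a, b) (by simp)
  rw [Multiset.erase_cons_head, Multiset.cons_swap s(a, b) s(a, g), Multiset.erase_cons_head]
  refine ⟨⟨?_, ?_, ?_, ?_⟩, ?_⟩
  · intro e he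
    rcases Multiset.mem_cons.1 he with rfl | he
    · simpa using hbg'.symm
    · refine hH.loopless e ?_
      rcases Multiset.mem_cons.1 he with rfl | he <;> simp [*]
  · intro v
    have := hH.even v
    simp only [degree_cons, Sym2.mem_iff] at this ⊢
    grind
  · intro S hS hcl
    refine hH.connected S hS fun p q hpq hp => ?_
    have h1 : a ∈ S ↔ b ∈ S :=
      ⟨hcl a b (by simp), hcl b a (by rw [Sym2.eq_swap]; simp)⟩
    have h2 : g ∈ S ↔ b ∈ S :=
      ⟨hcl g b (by simp), hcl b g (by rw [Sym2.eq_swap]; simp)⟩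
    -- The removed edge `ag` is bypassed by the path `a`, `b`, `g`, as one copy of `ab` survives.
    by_cases h : s(p, q) = s(a, g)
    · rcases Sym2.eq_iff.1 h with ⟨rfl, rfl⟩ | ⟨rfl, rfl⟩
      · exact h2.2 (h1.1 hp)
      · exact h1.2 (h2.1 hp)
    · refine hcl p q ?_ hp
      simp only [Multiset.mem_cons, h, false_or] at hpq ⊢
      tauto
  · intro v hv
    rw [innerDegree_cons_of_notMem (Sym2.mem_mk_left g b) hg]
    refine (innerDegree_mono ?_).trans (hH.inner v hv)
    refine Multiset.cons_le_cons _ ((Multiset.le_cons_self _ s(a, g)).trans ?_)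
    exact Multiset.le_cons_self _ _
  · intro d hd hG
    have h := hG g a b (Or.inl hg)
    rw [Sym2.eq_swap (a := g) (b := a)] at h
    simp only [cost_cons]
    linarith

lemma GraphInv.of_replaceDouble (hQ : IsBranch c Q) {H H' : Multiset (Sym2 V)}
    (hH : GraphInv c H) (h : ReplaceDouble c Q H H') :
    GraphInv c H' ∧ ∀ d : Sym2 V → ℝ, (∀ e, 0 ≤ d e) → TriangleOn d (good c) →
      cost d H' ≤ cost d H := by
  cases h with
  | first a b g hab hg hag =>
    exact hH.replace (hab.mem_bad hQ).1 (hab.mem_bad hQ).2 hg hab.2 hag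
  | second a b g hab hno hg hbg =>
    rw [Sym2.eq_swap (a := a)]
    exact hH.replace (hab.mem_bad hQ).2 (hab.mem_bad hQ).1 hg (Sym2.eq_swap ▸ hab.2) hbg

lemma ReplaceDouble.card_lt {H H' : Multiset (Sym2 V)} (h : ReplaceDouble c Q H H') :
    H'.card < H.card := by
  have key : ∀ (a b g : V) (e : Sym2 V), H.count s(a, b) = 2 → s(a, g) ∈ H →
      (e ::ₘ (H.erase s(a, b)).erase s(a, g)).card < H.card := by
    intro a b g e hab hag
    obtain ⟨E, rfl⟩ := exists_eq_cons_cons_of_count hab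
    have hmem : s(a, g) ∈ s(a, b) ::ₘ E := by simpa using hag
    rw [Multiset.erase_cons_head, Multiset.card_cons, Multiset.card_erase_of_mem hmem]
    simp
  cases h with
  | first a b g hab hg hag => exact key a b g _ hab.2 hag
  | second a b g hab hno hg hbg =>
    rw [Sym2.eq_swap (a := a)]
    exact key b a g _ (Sym2.eq_swap ▸ hab.2) hbg

/-- Without good neighbours all edges at `a` are inner, so its degree is at most 3. Being even, it
is 2, and the two copies of `ab` exhaust it. -/
lemma GraphInv.eq_of_doubleEdge {H : Multiset (Sym2 V)} (hH : GraphInv c H) {a b : V}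
    (ha : a ∈ bad c) (hab : H.count s(a, b) = 2) (hno : ∀ g ∈ good c, s(a, g) ∉ H) {q : V}
    (hq : s(a, q) ∈ H) : q = b := by
  by_contra hqb
  have hdeg : degree H a ≤ 3 := by
    rw [← innerDegree_eq_degree (B := bad c) (fun x hx => ?_) ha]
    · exact hH.inner a ha
    · exact not_not.1 fun h => hno x h hx
  have heven := hH.even a
  obtain ⟨E, rfl⟩ := exists_eq_cons_cons_of_count hab
  have hab' : a ≠ b := by simpa using hH.loopless s(a, b) (by simp)
  obtain ⟨E, rfl⟩ := Multiset.exists_cons_of_mem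
    (show s(a, q) ∈ E by simpa [hqb, hab'] using hq)
  simp only [degree_cons, Sym2.mem_mk_left, if_true] at hdeg heven
  grind

lemma GraphInv.exists_replaceDouble (hQ : IsBranch c Q) (hgood : (good c).Nonempty)
    {H : Multiset (Sym2 V)} (hH : GraphInv c H) {a b : V} (hab : IsDoubleEdge Q H a b) :
    ∃ H', ReplaceDouble c Q H H' := by
  obtain ⟨ha, hb⟩ := hab.mem_bad hQ
  by_cases h1 : ∃ g ∈ good c, s(a, g) ∈ H
  · obtain ⟨g, hg, hag⟩ := h1
    exact ⟨_, .first H a b g hab hg hag⟩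
  push Not at h1
  by_cases h2 : ∃ g ∈ good c, s(b, g) ∈ H
  · obtain ⟨g, hg, hbg⟩ := h2
    exact ⟨_, .second H a b g hab h1 hg hbg⟩
  push Not at h2
  -- If neither end has a good neighbour, `{a, b}` is a whole component, leaving no room for a good
  -- vertex.
  have huniv := hH.connected {a, b} ⟨a, by simp⟩ (by
    rintro p q hpq (rfl | hp)
    · exact Or.inr (hH.eq_of_doubleEdge ha hab.2 h1 hpq)
    · rw [Set.mem_singleton_iff.1 hp] at hpq
      exact Or.inl (hH.eq_of_doubleEdge hb (Sym2.eq_swap ▸ hab.2) h2 hpq))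
  obtain ⟨g, hg⟩ := hgood
  rcases huniv.ge (Set.mem_univ g) with rfl | h
  · exact absurd ha hg
  · exact absurd hb (Set.mem_singleton_iff.1 h ▸ hg)

/-- Two bad vertices are enough to keep `C` free of loops. -/
lemma IsBranch.two_le_length (hQ : IsBranch c Q) {T : Finset V} (hT : T ∈ violatingTriangles c) :
    2 ≤ Q.flatten.length := by
  have h : T ⊆ Q.flatten.toFinset := fun v hv => by
    rw [List.mem_toFinset, hQ.2.1]
    exact ⟨T, hT, hv⟩
  have := Finset.card_le_card h
  rw [hT.1, List.toFinset_card_of_nodup hQ.1] at this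
  omega

lemma degree_badCycle (hQ : IsBranch c Q) (hlen : 2 ≤ Q.flatten.length) (v : V) :
    degree (badCycle Q) v = 2 * Q.flatten.count v :=
  degree_cyclicEdges fun h => not_isDiag_of_mem_cyclicEdges hQ.1 hlen h (by simp)

/-! ### The multigraph composed of cycle, forest and matching -/

section Build

variable [Fintype V]

lemma not_isDiag_of_mem_cycleForest (hQ : IsBranch c Q) (hlen : 2 ≤ Q.flatten.length)
    (F : SimpleGraph V) : ∀ e ∈ cycleForest Q F, ¬ e.IsDiag := by
  intro e he
  rcases Multiset.mem_add.1 he with he | he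
  · exact not_isDiag_of_mem_cyclicEdges hQ.1 hlen he
  · exact F.not_isDiag_of_mem_edgeSet (mem_simpleEdges.1 he)

/-- The multigraph `H` that is passed to ShortCut satisfies the invariant. -/
lemma graphInv_build (hQ : IsBranch c Q) (hlen : 2 ≤ Q.flatten.length) {F : SimpleGraph V}
    {M : (⊤ : SimpleGraph V).Subgraph} (hF : IsBranchForest c Q F)
    (hM : IsBranchMatching c Q F M) : GraphInv c (cycleForest Q F + simpleEdges M.edgeSet) := by
  classical
  have hroots : ∀ r ∈ roots Q, r ∈ bad c := fun r hr => mem_bad_of_mem_chainEnds hQ hr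
  have hdegM := degree_simpleEdges_of_isMatching hM.1.1
  refine ⟨?_, ?_, ?_, ?_⟩
  · intro e he
    rcases Multiset.mem_add.1 he with he | he
    · exact not_isDiag_of_mem_cycleForest hQ hlen F e he
    · exact SimpleGraph.not_isDiag_of_mem_edgeSet _ (M.edgeSet_subset (mem_simpleEdges.1 he))
  · intro v
    rw [degree_add, hdegM, hM.1.2]
    by_cases hv : v ∈ oddVertices (cycleForest Q F)
    · rw [if_pos hv]
      exact Odd.add_one hv
    · rw [if_neg hv]
      exact Nat.not_odd_iff_even.1 hv
  · intro S hS hcl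
    -- A nonempty closed set contains a bad vertex, reached through a tree if necessary; then all
    -- bad vertices along `C`; then all good vertices through their trees.
    have hreach : ∀ u v, F.Reachable u v → u ∈ S → v ∈ S := by
      rintro u v ⟨p⟩
      induction p with
      | nil => exact id
      | cons h _ ih =>
        intro hu
        refine ih (hcl _ _ ?_ hu)
        exact Multiset.mem_add.2 (Or.inl (Multiset.mem_add.2 (Or.inr (mem_simpleEdges.2 h))))
    obtain ⟨b, hb, hbS⟩ : ∃ b ∈ bad c, b ∈ S := by
      obtain ⟨v, hv⟩ := hS
      by_cases hvb : v ∈ bad c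
      · exact ⟨v, hvb, hv⟩
      · obtain ⟨r, hr, -⟩ := hF.1.2.2 v (Or.inl hvb)
        exact ⟨r, hroots r hr.1, hreach v r hr.2 hv⟩
    have hbad : ∀ v ∈ bad c, v ∈ S := by
      intro v hv
      refine subset_of_closed_cyclicPairs (l := Q.flatten) (fun x y hxy => ?_)
        ((hQ.2.1 b).2 hb) hbS v ((hQ.2.1 v).2 hv)
      refine hcl x y (Multiset.mem_add.2 (Or.inl (Multiset.mem_add.2 (Or.inl ?_))))
      exact mem_cyclicEdges.2 ⟨x, y, hxy, rfl⟩
    refine Set.eq_univ_of_forall fun v => ?_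
    by_cases hvb : v ∈ bad c
    · exact hbad v hvb
    · obtain ⟨r, hr, -⟩ := hF.1.2.2 v (Or.inl hvb)
      exact hreach r v hr.2.symm (hbad r (hroots r hr.1))
  · intro b hb
    rw [innerDegree_add, cycleForest, innerDegree_add]
    -- The bound 3 is 2 from `C`, 0 from `F` and 1 from `M`: an inner forest edge would join two
    -- roots.
    have h1 : innerDegree (bad c) (badCycle Q) b ≤ 2 := by
      refine innerDegree_le_degree.trans ?_
      rw [degree_badCycle hQ hlen]
      have := List.nodup_iff_count_le_one.1 hQ.1 b
      omega
    have h2 : innerDegree (bad c) (simpleEdges F.edgeSet) b = 0 := by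
      refine Multiset.countP_eq_zero.2 fun e he h => ?_
      rw [mem_simpleEdges] at he
      induction e with
      | _ x y =>
        have hxy := hF.1.2.1 x y he
        refine hF.1.not_adj (r := x) (r' := y) ?_ ?_ he
        · exact hxy.1.resolve_left fun hx => hx (h.2 x (by simp))
        · exact hxy.2.resolve_left fun hy => hy (h.2 y (by simp))
    have h3 : innerDegree (bad c) (simpleEdges M.edgeSet) b ≤ 1 := by
      refine innerDegree_le_degree.trans ?_
      rw [hdegM]
      split_ifs <;> simp
    omega

end Build

/-! ### The sequences of the second loop -/

/-- The invariant of the loop over repeated bad vertices. -/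
structure SeqInv (c : Sym2 V → ℝ) (s : List V) : Prop where
  mem : ∀ v, v ∈ s
  loopless : ∀ b ∈ bad c, s(b, b) ∉ cyclicEdges s
  inner : ∀ b ∈ bad c, innerDegree (bad c) (cyclicEdges s) b ≤ 3

lemma GraphInv.seqInv [Nontrivial V] {H : Multiset (Sym2 V)} (hH : GraphInv c H) {s : List V}
    (hs : IsEulerTour H s) : SeqInv c s := by
  unfold IsEulerTour at hs
  subst hs
  refine ⟨fun v => ?_, fun b _ h => hH.loopless _ h (by simp), hH.inner⟩
  obtain ⟨w, hw⟩ := degree_pos.1 (hH.connected.degree_pos v)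
  exact mem_of_mem_cyclicEdges hw (by simp)

/-- The only new edge contains the good vertex `g`, so it is neither inner nor a loop at a bad
vertex. It can be a loop at `g`, as when `b` is skipped from `g b g`; this is why `loopless`
concerns bad vertices only. -/
lemma SeqInv.of_skipBad {s s' : List V} (hs : SeqInv c s) (h : SkipBad c s s') :
    SeqInv c s' ∧ ∀ d : Sym2 V → ℝ, TriangleOn d (good c) →
      cost d (cyclicEdges s') ≤ cost d (cyclicEdges s) := by
  cases h with
  | skip l₁ l₂ b g hb hrep hg hadj =>
    have hne : l₁ ++ l₂ ≠ [] := List.ne_nil_of_mem hrep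
    refine ⟨⟨?_, ?_, ?_⟩, fun d hG => cost_cyclicEdges_skip hG hne (Or.inr ⟨g, hg, hadj⟩)⟩
    · intro v
      by_cases hv : v = b
      · rwa [hv]
      · simpa [hv] using hs.mem v
    all_goals
      obtain ⟨x, y, E, hx, hy, h1, h2⟩ := exists_cyclicEdges_skip l₁ l₂ b hne
      have hgxy : g ∈ s(y, x) := by
        rcases hadj with h | h
        · rw [hx] at h
          simp [Option.some.inj h]
        · rw [hy] at h
          simp [Option.some.inj h]
      have hE : E ≤ cyclicEdges (l₁ ++ b :: l₂) := by
        rw [h1]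
        exact (Multiset.le_cons_self _ _).trans (Multiset.le_cons_self _ _)
      intro v hv
      rw [h2]
    · intro hmem
      rcases Multiset.mem_cons.1 hmem with h | h
      · rw [← h] at hgxy
        exact hg (by simpa using (show g = v by simpa using hgxy) ▸ hv)
      · exact hs.loopless v hv (Multiset.mem_of_le hE h)
    · rw [innerDegree_cons_of_notMem hgxy hg]
      exact (innerDegree_mono hE).trans (hs.inner v hv)

/-- If all neighbours of all occurrences of `b` were bad, the inner degree of `b` would be twice its
number of occurrences, hence at least 4. -/
lemma SeqInv.exists_skipBad {s : List V} (hs : SeqInv c s) {b : V} (hb : b ∈ bad c)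
    (hcount : 2 ≤ s.count b) : ∃ s', SkipBad c s s' := by
  have hne : s ≠ [b] := by
    rintro rfl
    simp at hcount
  have hrep : ∀ l₁ l₂, s = l₁ ++ b :: l₂ → b ∈ l₁ ++ l₂ := by
    rintro l₁ l₂ rfl
    rw [List.count_append, List.count_cons_self] at hcount
    rw [← List.count_pos_iff, List.count_append]
    omega
  obtain ⟨g, hbg, hg⟩ : ∃ g, s(b, g) ∈ cyclicEdges s ∧ g ∈ good c := by
    by_contra! h
    have h1 := innerDegree_eq_degree (B := bad c) (fun x hx => not_not.1 (h x hx)) hb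
    rw [degree_cyclicEdges (hs.loopless b hb)] at h1
    have := hs.inner b hb
    omega
  obtain ⟨x, y, hxy, h⟩ := mem_cyclicEdges.1 hbg
  rcases Sym2.eq_iff.1 h with ⟨rfl, rfl⟩ | ⟨rfl, rfl⟩
  · obtain ⟨l₁, l₂, hl, hhead⟩ := exists_split_of_mem_cyclicPairs hxy hne
    have := hrep l₁ l₂ hl
    subst hl
    exact ⟨_, .skip l₁ l₂ b g hb this hg (Or.inl hhead)⟩
  · obtain ⟨l₁, l₂, hl, hlast⟩ := exists_split_of_mem_cyclicPairs' hxy hne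
    have := hrep l₁ l₂ hl
    subst hl
    exact ⟨_, .skip l₁ l₂ b g hb this hg (Or.inr hlast)⟩

end ParamTSP

namespace ParamTSP

variable {V : Type*} {Q : List (List V)}

/-! ### Sequences of alternating bad and good blocks -/

section Interleave

variable {P : List (List V)}

/-- The sequence `q₁ p₁ q₂ p₂ … qₜ pₜ`. -/
def interleave (Q P : List (List V)) : List V :=
  (List.zipWith (fun q p => q ++ p) Q P).flatten

@[simp] lemma interleave_nil : interleave ([] : List (List V)) [] = [] := rfl

@[simp] lemma interleave_cons (q p : List V) (Q P : List (List V)) :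
    interleave (q :: Q) (p :: P) = q ++ p ++ interleave Q P := rfl

lemma filter_interleave {B : Set V} [DecidablePred (· ∈ B)] (hlen : P.length = Q.length)
    (hQ : ∀ q ∈ Q, ∀ v ∈ q, v ∈ B) (hP : ∀ p ∈ P, ∀ v ∈ p, v ∉ B) :
    (interleave Q P).filter (· ∈ B) = Q.flatten := by
  induction Q generalizing P with
  | nil =>
    rw [List.length_nil, List.length_eq_zero_iff] at hlen
    simp [hlen]
  | cons q Q ih =>
    cases P with
    | nil => simp at hlen
    | cons p P =>
      simp only [List.forall_mem_cons] at hQ hP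
      rw [interleave_cons, List.filter_append, List.filter_append,
        ih (by simpa using hlen) hQ.2 hP.2, List.filter_eq_self.2 (by simpa using hQ.1),
        List.filter_eq_nil_iff.2 (by simpa using hP.1)]
      simp

/-- Supplies the good successor of a chain end that makes the shortcuts in the bound for `M` free.
-/
lemma exists_next_of_mem_chainEnds {G : Set V} (hlen : P.length = Q.length)
    (hP : ∀ p ∈ P, p ≠ [] ∧ ∀ v ∈ p, v ∈ G) {a : V} (ha : a ∈ chainEnds Q) :
    ∃ l₁ g l₂, interleave Q P = l₁ ++ a :: g :: l₂ ∧ g ∈ G := by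
  induction Q generalizing P with
  | nil => simp [chainEnds] at ha
  | cons q Q ih =>
    cases P with
    | nil => simp at hlen
    | cons p P =>
      simp only [List.forall_mem_cons] at hP
      obtain ⟨q', hq', hqa⟩ := List.mem_filterMap.1 ha
      rcases List.mem_cons.1 hq' with rfl | hq'
      · obtain ⟨l₁, rfl⟩ := List.getLast?_eq_some_iff.1 hqa
        obtain ⟨g, p, rfl⟩ := List.exists_cons_of_ne_nil hP.1.1
        exact ⟨l₁, g, p ++ interleave Q P, by simp, hP.1.2 g (by simp)⟩
      · obtain ⟨l₁, g, l₂, h, hg⟩ := ih (by simpa using hlen) hP.2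
          (List.mem_filterMap.2 ⟨q', hq', hqa⟩)
        exact ⟨q ++ p ++ l₁, g, l₂, by simp [h], hg⟩

/-- Supplies the parents of the good vertices in the forest that is compared with `F`. -/
lemma exists_prev_of_mem {G : Set V} (hlen : P.length = Q.length)
    (hQ : ∀ q ∈ Q, q ≠ [] ∧ ∀ v ∈ q, v ∉ G)
    (hP : ∀ p ∈ P, ∀ v ∈ p, v ∈ G) {v : V} (hv : v ∈ interleave Q P) (hvG : v ∈ G) :
    ∃ l₁ u l₂, interleave Q P = l₁ ++ u :: v :: l₂ ∧ (u ∈ G ∨ u ∈ chainEnds Q) := by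
  induction Q generalizing P with
  | nil =>
    rw [List.length_nil, List.length_eq_zero_iff] at hlen
    simp [hlen] at hv
  | cons q Q ih =>
    cases P with
    | nil => simp at hlen
    | cons p P =>
      simp only [List.forall_mem_cons] at hP hQ
      rw [interleave_cons, List.mem_append, List.mem_append] at hv
      rcases hv with (hv | hv) | hv
      · exact absurd hvG (hQ.1.2 v hv)
      · obtain ⟨p₁, p₂, rfl⟩ := List.append_of_mem hv
        rcases List.eq_nil_or_concat p₁ with rfl | ⟨p₁, u, rfl⟩
        · obtain ⟨q₁, u, rfl⟩ := (List.eq_nil_or_concat q).resolve_left hQ.1.1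
          exact ⟨q₁, u, p₂ ++ interleave Q P, by simp,
            Or.inr (List.mem_filterMap.2 ⟨_, List.mem_cons_self, by simp⟩)⟩
        · exact ⟨q ++ p₁, u, p₂ ++ interleave Q P, by simp, Or.inl (hP.1 u (by simp))⟩
      · obtain ⟨l₁, u, l₂, h, hu⟩ := ih (by simpa using hlen) hQ.2 hP.2 hv
        refine ⟨q ++ p ++ l₁, u, l₂, by simp [h], hu.imp_right fun hu => ?_⟩
        obtain ⟨q', hq', hqa⟩ := List.mem_filterMap.1 hu
        exact List.mem_filterMap.2 ⟨q', List.mem_cons_of_mem _ hq', hqa⟩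

/-- The list is read from its end. A vertex outside `B` joins the leading block `p₀`; a vertex of
`B` joins the first chain if `p₀` is empty, and otherwise opens a chain with gap `p₀`. Since the
last vertex is outside `B`, every chain has a nonempty gap. -/
lemma exists_eq_append_interleave (B : Set V) (l : List V) {z : V} (hz : l.getLast? = some z)
    (hzB : z ∉ B) : ∃ (p₀ : List V) (Q P : List (List V)), P.length = Q.length ∧
      (∀ v ∈ p₀, v ∉ B) ∧ (∀ q ∈ Q, q ≠ [] ∧ ∀ v ∈ q, v ∈ B) ∧
      (∀ p ∈ P, p ≠ [] ∧ ∀ v ∈ p, v ∉ B) ∧ l = p₀ ++ interleave Q P := by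
  induction l with
  | nil => simp at hz
  | cons x l ih =>
    by_cases hl : l = []
    · subst hl
      have hxz : x = z := by simpa using hz
      exact ⟨[x], [], [], rfl, by simpa [hxz] using hzB, by simp, by simp, by simp⟩
    have hz' : l.getLast? = some z := by
      obtain ⟨y, l, rfl⟩ := List.exists_cons_of_ne_nil hl
      simpa [List.getLast?_cons_cons] using hz
    obtain ⟨p₀, Q, P, hlen, h₀, hQ, hP, rfl⟩ := ih hz'
    by_cases hx : x ∈ B
    · by_cases hp₀ : p₀ = []
      · subst hp₀
        cases Q with
        | nil =>
          rw [List.length_nil, List.length_eq_zero_iff] at hlen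
          simp [hlen] at hl
        | cons q Q =>
          cases P with
          | nil => simp at hlen
          | cons p P =>
            refine ⟨[], (x :: q) :: Q, p :: P, hlen, by simp, ?_, hP, by simp⟩
            rw [List.forall_mem_cons] at hQ ⊢
            exact ⟨⟨by simp, by simpa [hx] using hQ.1.2⟩, hQ.2⟩
      · exact ⟨[], [x] :: Q, p₀ :: P, by simpa using hlen, by simp,
          List.forall_mem_cons.2 ⟨⟨by simp, by simpa using hx⟩, hQ⟩,
          List.forall_mem_cons.2 ⟨⟨hp₀, h₀⟩, hP⟩, by simp⟩
    · exact ⟨x :: p₀, Q, P, hlen, by simpa [hx] using h₀, hQ, hP, by simp⟩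

/-- Every cyclic sequence that meets `B` and its complement consists of alternating nonempty blocks
inside and outside `B`. -/
lemma exists_isRotated_interleave (B : Set V) {τ : List V} {b g : V} (hb : b ∈ τ) (hbB : b ∈ B)
    (hg : g ∈ τ) (hgB : g ∉ B) : ∃ Q P : List (List V), P.length = Q.length ∧
      (∀ q ∈ Q, q ≠ [] ∧ ∀ v ∈ q, v ∈ B) ∧ (∀ p ∈ P, p ≠ [] ∧ ∀ v ∈ p, v ∉ B) ∧
      τ ~r interleave Q P := by
  obtain ⟨l₁, l₂, rfl⟩ := List.append_of_mem hg
  have hrot : l₁ ++ g :: l₂ ~r l₂ ++ (l₁ ++ [g]) := by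
    have := List.isRotated_append (l := l₁ ++ [g]) (l' := l₂)
    simpa using this
  obtain ⟨p₀, Q, P, hlen, h₀, hQ, hP, h⟩ :=
    exists_eq_append_interleave B (l₂ ++ (l₁ ++ [g])) (z := g) (by simp) hgB
  cases Q with
  | nil =>
    rw [List.length_nil, List.length_eq_zero_iff] at hlen
    subst hlen
    have hb' := hrot.mem_iff.1 hb
    rw [h] at hb'
    exact absurd hbB (h₀ b (by simpa using hb'))
  | cons q Q =>
    -- With `p₀` moved to the end, the list starts inside `B` and ends outside. Decomposing it again
    -- gives an empty leading block and absorbs `p₀` into the last gap.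
    have hrot' : l₁ ++ g :: l₂ ~r interleave (q :: Q) P ++ p₀ :=
      hrot.trans (h ▸ List.isRotated_append)
    have hlast : ∃ z, (interleave (q :: Q) P ++ p₀).getLast? = some z ∧ z ∉ B := by
      rcases List.eq_nil_or_concat p₀ with rfl | ⟨p₀, z, rfl⟩
      · refine ⟨g, ?_, hgB⟩
        rw [List.append_nil, ← List.nil_append (interleave _ _), ← h]
        simp
      · exact ⟨z, by simp, h₀ z (by simp)⟩
    obtain ⟨z, hz, hzB⟩ := hlast
    obtain ⟨p₁, Q', P', hlen', h₁, hQ', hP', h'⟩ := exists_eq_append_interleave B _ hz hzB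
    refine ⟨Q', P', hlen', hQ', hP', ?_⟩
    have hp₁ : p₁ = [] := by
      cases P with
      | nil => simp at hlen
      | cons p P =>
        obtain ⟨x, q, rfl⟩ := List.exists_cons_of_ne_nil (hQ q (by simp)).1
        cases p₁ with
        | nil => rfl
        | cons y p₁ =>
          simp only [interleave_cons, List.cons_append, List.cons.injEq] at h'
          exact absurd ((hQ (x :: q) (by simp)).2 x (by simp)) (h'.1 ▸ h₁ y (by simp))
    rw [h', hp₁] at hrot'
    exact hrot'

end Interleave

variable [DecidableEq V] {c : Sym2 V → ℝ}

/-! ### Comparison with an optimal tour -/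

/-- Every tour that contains good vertices is matched by a branch. -/
lemma exists_isBranch_matches {τ : List V} (hτ : IsTour τ) (hbad : (bad c).Nonempty)
    (hgood : (good c).Nonempty) : ∃ Q, IsBranch c Q ∧ Matches c Q τ := by
  classical
  obtain ⟨b, hb⟩ := hbad
  obtain ⟨g, hg⟩ := hgood
  obtain ⟨Q, P, hlen, hQ, hP, hrot⟩ :=
    exists_isRotated_interleave (bad c) (hτ.2 b) hb (hτ.2 g) hg
  refine ⟨Q, ⟨?_, fun v => ?_, fun q hq => (hQ q hq).1⟩, P, hlen, hP, hrot⟩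
  · rw [← filter_interleave hlen (fun q hq => (hQ q hq).2) (fun p hp => (hP p hp).2)]
    exact (hrot.nodup_iff.1 hτ.1).filter _
  · rw [← filter_interleave hlen (fun q hq => (hQ q hq).2) (fun p hp => (hP p hp).2),
      List.mem_filter]
    simp [← hrot.mem_iff, hτ.2 v]

lemma IsTour.not_isDiag [Nontrivial V] {τ : List V} (hτ : IsTour τ) :
    ∀ e ∈ cyclicEdges τ, ¬ e.IsDiag := by
  obtain ⟨x, y, hxy⟩ := exists_pair_ne V
  refine fun e he => not_isDiag_of_mem_cyclicEdges hτ.1 ?_ he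
  have h : ({x, y} : Finset V) ⊆ τ.toFinset := fun v _ => by simpa using hτ.2 v
  have := Finset.card_le_card h
  rwa [Finset.card_pair hxy, List.toFinset_card_of_nodup hτ.1] at this

/-- Skipping the good vertices of the tour leaves exactly the cyclic sequence of `C`. -/
lemma cost_badCycle_le [Nontrivial V] (hc : ∀ e ∈ (⊤ : SimpleGraph V).edgeSet, 0 ≤ c e)
    (hQ : IsBranch c Q) (hlen : 2 ≤ Q.flatten.length) {τ : List V} (hτ : IsTour τ)
    (hm : Matches c Q τ) :
    cost c (badCycle Q) ≤ cost c (cyclicEdges τ) := by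
  classical
  obtain ⟨P, hPlen, hP, hrot⟩ := hm
  have h := filter_interleave (B := bad c) hPlen
    (fun q hq v hv => (hQ.2.1 v).1 (List.mem_flatten.2 ⟨q, hq, hv⟩)) (fun p hp => (hP p hp).2)
  rw [← cost_zeroDiag c hτ.not_isDiag, cyclicEdges_isRotated hrot,
    ← cost_zeroDiag c (E := badCycle Q) (fun e => not_isDiag_of_mem_cyclicEdges hQ.1 hlen),
    badCycle, ← h]
  exact cost_cyclicEdges_filter_of_good (zeroDiag_nonneg hc) (triangleOn_good hc) (· ∈ bad c) _
    fun y _ hy => hy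

variable [Fintype V]

lemma IsMinPerfectMatching.zeroDiag {O : Set V} {M : (⊤ : SimpleGraph V).Subgraph}
    (hM : IsMinPerfectMatching c O M) : IsMinPerfectMatching (zeroDiag c) O M := by
  have h : ∀ M : (⊤ : SimpleGraph V).Subgraph, cost (ParamTSP.zeroDiag c) (simpleEdges M.edgeSet) =
      cost c (simpleEdges M.edgeSet) := fun M => cost_zeroDiag c fun e he =>
    SimpleGraph.not_isDiag_of_mem_edgeSet _ (M.edgeSet_subset (mem_simpleEdges.1 he))
  refine ⟨hM.1, fun M' hM' => ?_⟩
  rw [h, h]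
  exact hM.2 M' hM'

section Compare

variable [Nontrivial V]

/-- Taking the predecessor on the tour as parent and the position in `interleave Q P` as rank gives
a rooted spanning forest whose edges are tour edges. -/
lemma cost_forest_le (hc : ∀ e ∈ (⊤ : SimpleGraph V).edgeSet, 0 ≤ c e) (hQ : IsBranch c Q)
    {τ : List V} (hτ : IsTour τ) (hm : Matches c Q τ)
    {F : SimpleGraph V} (hF : IsBranchForest c Q F) :
    cost c (simpleEdges F.edgeSet) ≤ cost c (cyclicEdges τ) := by
  classical
  obtain ⟨P, hPlen, hP, hrot⟩ := hm
  have hnodup : (interleave Q P).Nodup := hrot.nodup_iff.1 hτ.1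
  have hprev : ∀ v ∈ good c, ∃ u l₁ l₂, interleave Q P = l₁ ++ u :: v :: l₂ ∧
      u ∈ good c ∪ roots Q := by
    intro v hv
    obtain ⟨l₁, u, l₂, h⟩ := exists_prev_of_mem hPlen
      (fun q hq => ⟨hQ.2.2 q hq, fun v hv => not_not.2
        ((hQ.2.1 v).1 (List.mem_flatten.2 ⟨q, hq, hv⟩))⟩)
      (fun p hp => (hP p hp).2) (hrot.mem_iff.1 (hτ.2 v)) hv
    exact ⟨u, l₁, l₂, h⟩
  choose! f hf using hprev
  have hforest := isRootedSpanningForest_parentGraph (G := good c) (R := roots Q) (f := f)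
    (rank := fun v => (interleave Q P).idxOf v)
    (fun v hv hvg => hvg (mem_bad_of_mem_chainEnds hQ hv)) (fun v hv => by
      obtain ⟨l₁, l₂, h, -⟩ := hf v hv
      rw [h] at hnodup
      have hv₁ : v ∉ l₁ := fun hv₁ => (List.nodup_append.1 hnodup).2.2 v hv₁ v (by simp) rfl
      have hu₁ : f v ∉ l₁ := fun hu₁ => (List.nodup_append.1 hnodup).2.2 _ hu₁ (f v) (by simp) rfl
      have huv : f v ≠ v := fun h => by
        have := (List.nodup_append.1 hnodup).2.1
        simp [h] at this
      simp only [h]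
      rw [List.idxOf_append_of_notMem hv₁, List.idxOf_append_of_notMem hu₁, List.idxOf_cons_self,
        List.idxOf_cons_ne _ huv]
      omega) (fun v hv => (hf v hv).choose_spec.choose_spec.2)
  have hle : ∀ e ∈ (parentGraph (good c) f).edgeSet, e ∈ cyclicEdges τ := by
    have key : ∀ v ∈ good c, s(f v, v) ∈ cyclicEdges τ := by
      intro v hv
      obtain ⟨l₁, l₂, h, -⟩ := hf v hv
      rw [cyclicEdges_isRotated hrot]
      change _ ∈ cyclicEdges (interleave Q P)
      rw [h]
      exact mem_cyclicEdges_of_append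
    intro e
    induction e with
    | _ x y =>
      rintro ⟨-, ⟨h, h'⟩ | ⟨h, h'⟩⟩ <;> dsimp only at h h'
      · rw [h', Sym2.eq_swap]
        exact key _ h
      · rw [h']
        exact key _ h
  refine (hF.2 _ hforest).trans ?_
  rw [← cost_zeroDiag c hτ.not_isDiag, ← cost_zeroDiag c fun e he =>
    SimpleGraph.not_isDiag_of_mem_edgeSet _ (mem_simpleEdges.1 he)]
  exact cost_mono (zeroDiag_nonneg hc) (simpleEdges_le hle)

/-- The tour restricted to the odd vertices `O` is a cycle of even length costing no more than the
tour, and a minimum matching costs at most half of it. -/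
lemma cost_matching_le (hc : ∀ e ∈ (⊤ : SimpleGraph V).edgeSet, 0 ≤ c e) (hQ : IsBranch c Q)
    (hlen : 2 ≤ Q.flatten.length) {τ : List V} (hτ : IsTour τ) (hm : Matches c Q τ)
    {F : SimpleGraph V} (hF : IsBranchForest c Q F)
    {M : (⊤ : SimpleGraph V).Subgraph} (hM : IsBranchMatching c Q F M) :
    cost c (simpleEdges M.edgeSet) ≤ cost c (cyclicEdges τ) / 2 := by
  classical
  obtain ⟨P, hPlen, hP, hrot⟩ := hm
  set O := oddVertices (cycleForest Q F) with hO
  have hnodup : (interleave Q P).Nodup := hrot.nodup_iff.1 hτ.1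
  -- Degrees in `C` are even, so an odd vertex has a forest edge; a bad vertex of the forest is a
  -- root.
  have hroot : ∀ a ∈ O, a ∉ good c → a ∈ chainEnds Q := by
    intro a ha hag
    have hodd : Odd (degree (cycleForest Q F) a) := ha
    rw [cycleForest, degree_add, degree_badCycle hQ hlen] at hodd
    have hpos : 0 < degree (simpleEdges F.edgeSet) a := by
      by_contra h0
      rw [Nat.eq_zero_of_not_pos h0, add_zero] at hodd
      exact (Nat.not_odd_iff_even.2 (even_two_mul _)) hodd
    obtain ⟨w, hw⟩ := degree_pos.1 hpos
    exact ((hF.1.2.1 a w (mem_simpleEdges.1 hw)).1).resolve_left hag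
  have hmemO : ∀ v, v ∈ (interleave Q P).filter (· ∈ O) ↔ v ∈ O := by
    intro v
    have := hrot.mem_iff.1 (hτ.2 v)
    simp only [List.mem_filter, decide_eq_true_eq, and_iff_right_iff_imp]
    exact fun _ => this
  have heven : Even ((interleave Q P).filter (· ∈ O)).length := by
    have h := even_ncard_oddVertices (not_isDiag_of_mem_cycleForest hQ hlen F)
    rw [← hO, Set.ncard_eq_toFinset_card'] at h
    rw [← List.toFinset_card_of_nodup (hnodup.filter _)]
    convert h using 2
    ext v
    rw [List.mem_toFinset, hmemO, Set.mem_toFinset]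
  have h1 := hM.zeroDiag.two_mul_cost_le (zeroDiag_nonneg hc) (hnodup.filter (· ∈ O)) hmemO heven
  have h2 := cost_cyclicEdges_filter (zeroDiag_nonneg hc) (triangleOn_good hc) (· ∈ O)
    (interleave Q P) (by
      intro a b hab ha hag
      obtain ⟨l₁, g, l₂, h, hg⟩ := exists_next_of_mem_chainEnds hPlen hP (hroot a ha hag)
      have hag' : (a, g) ∈ cyclicPairs (interleave Q P) := by
        rw [h, mem_cyclicPairs_isRotated (List.isRotated_append (l := l₁)), List.cons_append,
          List.cons_append, cyclicPairs_cons]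
        simp
      rwa [cyclicPairs_right_unique hnodup hab hag'])
  rw [cost_zeroDiag c fun e he => SimpleGraph.not_isDiag_of_mem_edgeSet _
    (M.edgeSet_subset (mem_simpleEdges.1 he))] at h1
  have h3 : cost (zeroDiag c) (cyclicEdges (interleave Q P)) = cost c (cyclicEdges τ) := by
    rw [← cost_zeroDiag c hτ.not_isDiag, cyclicEdges_isRotated hrot]
    rfl
  linarith

end Compare

end ParamTSP

namespace ParamTSP

variable {V : Type*} [Fintype V] [DecidableEq V] {c : Sym2 V → ℝ} {Q : List (List V)}

/-! ### The computation in a branch -/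

/-- `r` is at most the cost of some multigraph that may be passed to ShortCut. -/
def BuildBound (c : Sym2 V → ℝ) (Q : List (List V)) (r : ℝ) : Prop :=
  (good c).Nonempty ∧ ∃ F M, IsBranchForest c Q F ∧ IsBranchMatching c Q F M ∧
    r ≤ cost (zeroDiag c) (cycleForest Q F + simpleEdges M.edgeSet)

lemma BuildBound.mono {r r' : ℝ} (h : BuildBound c Q r) (hr : r' ≤ r) : BuildBound c Q r' := by
  obtain ⟨hg, F, M, hF, hM, h⟩ := h
  exact ⟨hg, F, M, hF, hM, hr.trans h⟩

/-- The invariant of the computation in a branch. -/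
def StateInv (c : Sym2 V → ℝ) (Q : List (List V)) : State V → Prop
  | .start => True
  | .doubleEdges H => GraphInv c H ∧ BuildBound c Q (cost (zeroDiag c) H)
  | .badRepeats s => SeqInv c s ∧ BuildBound c Q (cost (zeroDiag c) (cyclicEdges s))
  | .goodRepeats s => ((∀ v, v ∈ s) ∧ ∀ b ∈ bad c, s.count b ≤ 1) ∧
      BuildBound c Q (cost (zeroDiag c) (cyclicEdges s))
  | .output s => IsTour s ∧ ((good c = ∅ ∧ s = Q.flatten) ∨
      BuildBound c Q (cost (zeroDiag c) (cyclicEdges s)))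

/-- No transition after the construction of the multigraph raises the `zeroDiag` cost, so the bound
by `C`, `F` and `M` is handed on to the output. -/
lemma StateInv.of_step [Nontrivial V] (hc : ∀ e ∈ (⊤ : SimpleGraph V).edgeSet, 0 ≤ c e)
    (hQ : IsBranch c Q) (hlen : 2 ≤ Q.flatten.length) {x y : State V} (hx : StateInv c Q x)
    (h : BranchStep c Q x y) : StateInv c Q y := by
  have hd := zeroDiag_nonneg hc
  have hG := triangleOn_good hc
  cases h with
  | trivial h =>
    refine ⟨⟨hQ.1, fun v => (hQ.2.1 v).2 ?_⟩, Or.inl ⟨h, rfl⟩⟩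
    by_contra hv
    exact (h.le hv : v ∈ (∅ : Set V))
  | build h F M hF hM => exact ⟨graphInv_build hQ hlen hF hM, h, F, M, hF, hM, le_rfl⟩
  | replace H H' h =>
    have := hx.1.of_replaceDouble hQ h
    exact ⟨this.1, hx.2.mono (this.2 _ hd hG)⟩
  | euler H h s hs =>
    refine ⟨hx.1.seqInv hs, ?_⟩
    rw [show cyclicEdges s = H from hs]
    exact hx.2
  | skipBad s s' h =>
    have := hx.1.of_skipBad h
    exact ⟨this.1, hx.2.mono (this.2 _ hG)⟩
  | badUnique s h => exact ⟨⟨hx.1.mem, h⟩, hx.2⟩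
  | skipGood s s' h =>
    cases h with
    | skip l₁ l₂ g hg hrep =>
      refine ⟨⟨fun v => ?_, fun b hb => ?_⟩,
        hx.2.mono (cost_cyclicEdges_skip hG (List.ne_nil_of_mem hrep) (Or.inl hg))⟩
      · by_cases hv : v = g
        · rwa [hv]
        · simpa [hv] using hx.1.1 v
      · refine le_trans (List.Sublist.count_le b ?_) (hx.1.2 b hb)
        exact (List.sublist_cons_self g l₂).append_left l₁
  | goodUnique s h =>
    refine ⟨⟨List.nodup_iff_count_le_one.2 fun v => ?_, hx.1.1⟩, Or.inr hx.2⟩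
    by_cases hv : v ∈ bad c
    · exact hx.1.2 v hv
    · exact h v hv

lemma Reaches.stateInv [Nontrivial V] (hc : ∀ e ∈ (⊤ : SimpleGraph V).edgeSet, 0 ≤ c e)
    (hQ : IsBranch c Q) (hlen : 2 ≤ Q.flatten.length) {x : State V} (hx : Reaches c Q x) :
    StateInv c Q x := by
  induction hx with
  | refl => exact True.intro
  | tail _ h ih => exact ih.of_step hc hQ hlen h

/-- A feasible forest is the star joining all good vertices to a single chain end. -/
lemma exists_isBranchForest (hQ : IsBranch c Q) (hbad : (bad c).Nonempty) :
    ∃ F, IsBranchForest c Q F := by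
  classical
  obtain ⟨b, hb⟩ := hbad
  obtain ⟨q, hq, -⟩ := List.mem_flatten.1 ((hQ.2.1 b).2 hb)
  have hr : q.getLast (hQ.2.2 q hq) ∈ roots Q :=
    List.mem_filterMap.2 ⟨q, hq, List.getLast?_eq_some_getLast _⟩
  have hgood : ∀ r ∈ roots Q, r ∉ good c := fun r hr h => h (mem_bad_of_mem_chainEnds hQ hr)
  refine exists_isRootedMSF c ⟨_, isRootedSpanningForest_parentGraph
    (f := fun _ => q.getLast (hQ.2.2 q hq)) (rank := fun v => if v ∈ good c then 1 else 0)
    hgood (fun v hv => ?_) (fun v _ => Or.inr hr)⟩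
  simp [hgood _ hr, hv]

lemma exists_isBranchMatching (hQ : IsBranch c Q) (hlen : 2 ≤ Q.flatten.length)
    (F : SimpleGraph V) : ∃ M, IsBranchMatching c Q F M :=
  exists_isMinPerfectMatching c (even_ncard_oddVertices (not_isDiag_of_mem_cycleForest hQ hlen F))

lemma StateInv.exists_step (hQ : IsBranch c Q) (hlen : 2 ≤ Q.flatten.length) {x : State V}
    (hx : StateInv c Q x) : (∃ y, BranchStep c Q x y) ∨ ∃ s, x = .output s := by
  cases x with
  | start =>
    left
    rcases (good c).eq_empty_or_nonempty with h | h
    · exact ⟨_, .trivial h⟩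
    · obtain ⟨b, hb⟩ := List.exists_mem_of_length_pos (by omega : 0 < Q.flatten.length)
      obtain ⟨F, hF⟩ := exists_isBranchForest hQ ⟨b, (hQ.2.1 b).1 hb⟩
      obtain ⟨M, hM⟩ := exists_isBranchMatching hQ hlen F
      exact ⟨_, .build h F M hF hM⟩
  | doubleEdges H =>
    left
    by_cases h : ∃ a b, IsDoubleEdge Q H a b
    · obtain ⟨a, b, hab⟩ := h
      obtain ⟨H', hH'⟩ := hx.1.exists_replaceDouble hQ hx.2.1 hab
      exact ⟨_, .replace H H' hH'⟩
    · push Not at h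
      obtain ⟨s, hs⟩ := exists_isEulerTour hx.1.loopless hx.1.even hx.1.connected
      exact ⟨_, .euler H h s hs⟩
  | badRepeats s =>
    left
    by_cases h : ∀ b ∈ bad c, s.count b ≤ 1
    · exact ⟨_, .badUnique s h⟩
    · push Not at h
      obtain ⟨b, hb, hcount⟩ := h
      obtain ⟨s', hs'⟩ := hx.1.exists_skipBad hb hcount
      exact ⟨_, .skipBad s s' hs'⟩
  | goodRepeats s =>
    left
    by_cases h : ∀ g ∈ good c, s.count g ≤ 1
    · exact ⟨_, .goodUnique s h⟩
    · push Not at h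
      obtain ⟨g, hg, hcount⟩ := h
      obtain ⟨l₁, l₂, rfl⟩ := List.append_of_mem (List.count_pos_iff.1 (by omega : 0 < s.count g))
      refine ⟨_, .skipGood _ _ (.skip l₁ l₂ g hg ?_)⟩
      rw [List.count_append, List.count_cons_self] at hcount
      rw [← List.count_pos_iff, List.count_append]
      omega
  | output s => exact Or.inr ⟨s, rfl⟩

/-- A measure that decreases in every transition. -/
def stateMeasure : State V → ℕ ×ₗ ℕ
  | .start => toLex (4, 0)
  | .doubleEdges H => toLex (3, H.card)
  | .badRepeats s => toLex (2, s.length)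
  | .goodRepeats s => toLex (1, s.length)
  | .output _ => toLex (0, 0)

lemma BranchStep.stateMeasure_lt {x y : State V} (h : BranchStep c Q x y) :
    stateMeasure y < stateMeasure x := by
  cases h with
  | replace H H' h => exact Prod.Lex.toLex_lt_toLex.2 (Or.inr ⟨rfl, h.card_lt⟩)
  | skipBad s s' h =>
    cases h with
    | skip l₁ l₂ b g => exact Prod.Lex.toLex_lt_toLex.2 (Or.inr ⟨rfl, by simp⟩)
  | skipGood s s' h =>
    cases h with
    | skip l₁ l₂ g => exact Prod.Lex.toLex_lt_toLex.2 (Or.inr ⟨rfl, by simp⟩)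
  | _ => exact Prod.Lex.toLex_lt_toLex.2 (Or.inl (by simp))

lemma wellFounded_branchStep (c : Sym2 V → ℝ) (Q : List (List V)) :
    WellFounded fun y x => BranchStep c Q x y :=
  Subrelation.wf (fun h => h.stateMeasure_lt) (InvImage.wf stateMeasure wellFounded_lt)

/-- In every branch some computation produces an output. -/
lemma exists_reaches_output [Nontrivial V] (hc : ∀ e ∈ (⊤ : SimpleGraph V).edgeSet, 0 ≤ c e)
    (hQ : IsBranch c Q) (hlen : 2 ≤ Q.flatten.length) : ∃ s, Reaches c Q (.output s) := by
  -- A minimal reachable state has no successor, so by progress it is an output.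
  obtain ⟨x, hx, hmin⟩ := (wellFounded_branchStep c Q).has_min {x | Reaches c Q x}
    ⟨.start, Relation.ReflTransGen.refl⟩
  rcases (hx.stateInv hc hQ hlen).exists_step hQ hlen with ⟨y, hy⟩ | ⟨s, rfl⟩
  · exact absurd hy (hmin y (hx.tail hy))
  · exact ⟨s, hx⟩

/-- In a branch that matches an optimal tour, the output is a 2.5-approximation. -/
lemma cost_output_le [Nontrivial V] (hc : ∀ e ∈ (⊤ : SimpleGraph V).edgeSet, 0 ≤ c e)
    (hQ : IsBranch c Q) (hlen : 2 ≤ Q.flatten.length) {τ : List V} (hτ : IsTour τ)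
    (hm : Matches c Q τ) (hgood : (good c).Nonempty) {s : List V}
    (hs : Reaches c Q (.output s)) :
    cost c (cyclicEdges s) ≤ 5 / 2 * cost c (cyclicEdges τ) := by
  obtain ⟨htour, ⟨h, -⟩ | ⟨-, F, M, hF, hM, hle⟩⟩ := hs.stateInv hc hQ hlen
  · exact absurd h hgood.ne_empty
  rw [cost_zeroDiag c htour.not_isDiag, cost_zeroDiag c (graphInv_build hQ hlen hF hM).loopless,
    cycleForest, cost_add, cost_add] at hle
  have h1 := cost_badCycle_le hc hQ hlen hτ hm
  have h2 := cost_forest_le hc hQ hτ hm hF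
  have h3 := cost_matching_le hc hQ hlen hτ hm hF hM
  linarith

/-- The algorithm has an output. -/
lemma exists_algorithmOutput (hQ : ∃ Q, IsBranch c Q)
    (hout : ∀ Q, IsBranch c Q → ∃ s, Reaches c Q (.output s))
    (htour : ∀ Q, IsBranch c Q → ∀ s, Reaches c Q (.output s) → IsTour s) :
    ∃ s, AlgorithmOutput c s := by
  choose! out hout using hout
  -- Finiteness of the outputs, which are lists without repetition, replaces a count of the
  -- branches.
  have hfin : {s | ∃ Q, IsBranch c Q ∧ s = out Q}.Finite := by
    refine (List.finite_length_le V (Fintype.card V)).subset ?_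
    rintro _ ⟨Q, hQ, rfl⟩
    exact (htour Q hQ _ (hout Q hQ)).1.length_le_card
  obtain ⟨Q, hQ⟩ := hQ
  obtain ⟨s, hs, hmin⟩ := Set.exists_min_image _ (fun s => cost c (cyclicEdges s)) hfin
    ⟨_, Q, hQ, rfl⟩
  exact ⟨s, out, hout, hs, fun Q hQ => hmin _ ⟨Q, hQ, rfl⟩⟩

/-- Enumerating the bad vertices as one-vertex chains is a branch. -/
lemma exists_isBranch (c : Sym2 V → ℝ) : ∃ Q, IsBranch c Q := by
  classical
  have h : ∀ l : List V, (l.map fun v => [v]).flatten = l := fun l => by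
    induction l with
    | nil => rfl
    | cons x l ih => simpa using ih
  refine ⟨(bad c).toFinset.toList.map fun v => [v], ?_, ?_, by simp⟩
  · rw [h]
    exact Finset.nodup_toList _
  · simp [h]

end ParamTSP

/-! ### The approximation theorem -/

theorem mainTheorem1 {V : Type*} [Fintype V] [DecidableEq V] (c : Sym2 V → ℝ)
    (hc : ∀ e ∈ (⊤ : SimpleGraph V).edgeSet, 0 ≤ c e)
    (k : ℕ) (hk : (violatingTriangles c).ncard = k) (hk1 : 1 ≤ k) :
    -- in every branch, every computation ends, and ends with a Hamiltonian cycle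
    (∀ Q, IsBranch c Q → Terminates c Q ∧ NeverStuck c Q ∧
      ∀ s, Reaches c Q (.output s) → IsTour s) ∧
    -- the branches that match an optimal tour
    (∀ τ, IsOptimalTour c τ → (good c).Nonempty →
      (∃ Q, IsBranch c Q ∧ Matches c Q τ) ∧
      ∀ Q, IsBranch c Q → Matches c Q τ →
        cost c (badCycle Q) ≤ cost c (cyclicEdges τ) ∧
        (∀ F, IsBranchForest c Q F →
          cost c (simpleEdges F.edgeSet) ≤ cost c (cyclicEdges τ) ∧
          ∀ M, IsBranchMatching c Q F M →
            cost c (simpleEdges M.edgeSet) ≤ cost c (cyclicEdges τ) / 2) ∧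
        ∀ s, Reaches c Q (.output s) →
          cost c (cyclicEdges s) ≤ 5 / 2 * cost c (cyclicEdges τ)) ∧
    -- the algorithm as a whole
    (∃ s, AlgorithmOutput c s) ∧
    ∀ s, AlgorithmOutput c s → IsTour s ∧
      ∀ τ, IsOptimalTour c τ → cost c (cyclicEdges s) ≤ 5 / 2 * cost c (cyclicEdges τ) := by
  obtain ⟨T, hT⟩ : (violatingTriangles c).Nonempty :=
    Set.nonempty_of_ncard_ne_zero (by omega)
  have hlen : ∀ Q, IsBranch c Q → 2 ≤ Q.flatten.length := fun Q hQ => hQ.two_le_length hT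
  obtain ⟨x, y, z, hxy, -⟩ := Finset.card_eq_three.1 hT.1
  have : Nontrivial V := ⟨x, y, hxy⟩
  have hbad : (bad c).Nonempty := by
    obtain ⟨v, hv⟩ := Finset.card_pos.1 (by rw [hT.1]; norm_num : 0 < T.card)
    exact ⟨v, T, hT, hv⟩
  have htour : ∀ Q, IsBranch c Q → ∀ s, Reaches c Q (.output s) → IsTour s :=
    fun Q hQ s hs => (hs.stateInv hc hQ (hlen Q hQ)).1
  refine ⟨fun Q hQ => ⟨(wellFounded_branchStep c Q).apply _,
    fun x hx => (hx.stateInv hc hQ (hlen Q hQ)).exists_step hQ (hlen Q hQ), htour Q hQ⟩,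
    fun τ hτ hgood => ⟨exists_isBranch_matches hτ.1 hbad hgood, fun Q hQ hm =>
      ⟨cost_badCycle_le hc hQ (hlen Q hQ) hτ.1 hm, fun F hF => ⟨cost_forest_le hc hQ hτ.1 hm hF,
        fun M hM => cost_matching_le hc hQ (hlen Q hQ) hτ.1 hm hF hM⟩,
        fun s hs => cost_output_le hc hQ (hlen Q hQ) hτ.1 hm hgood hs⟩⟩,
    exists_algorithmOutput (exists_isBranch c)
      (fun Q hQ => exists_reaches_output hc hQ (hlen Q hQ)) htour, ?_⟩
  rintro s ⟨out, hout, ⟨Q, hQ, rfl⟩, hmin⟩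
  refine ⟨htour Q hQ _ (hout Q hQ), fun τ hτ => ?_⟩
  rcases (good c).eq_empty_or_nonempty with h | h
  -- If all vertices are bad, the optimal tour taken as a single chain is a branch and is its own
  -- output; nonnegativity then gives the factor 5/2.
  · have hτQ : IsBranch c [τ] := by
      refine ⟨by simpa using hτ.1.1, fun v => ?_, by simpa using List.ne_nil_of_mem (hτ.1.2 x)⟩
      simp only [List.flatten_cons, List.flatten_nil, List.append_nil, hτ.1.2 v, true_iff]
      by_contra hv
      exact (h.le hv : v ∈ (∅ : Set V))
    have hout' : out [τ] = τ := by
      obtain ⟨-, ⟨-, h'⟩ | ⟨h', -⟩⟩ := (hout _ hτQ).stateInv hc hτQ (hlen _ hτQ)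
      · simpa using h'
      · exact absurd h h'.ne_empty
    have h1 := hmin _ hτQ
    rw [hout'] at h1
    have h2 : 0 ≤ cost c (cyclicEdges τ) := by
      rw [← cost_zeroDiag c hτ.1.not_isDiag]
      exact cost_nonneg (zeroDiag_nonneg hc) _
    linarith
  · obtain ⟨Q', hQ', hm⟩ := exists_isBranch_matches hτ.1 hbad h
    exact (hmin Q' hQ').trans
      (cost_output_le hc hQ' (hlen Q' hQ') hτ.1 hm h (hout Q' hQ'))
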